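/- **Theorem (Marginal coverage: $\beta$-mixing).** Let $(Z_t)_{t\in\mathbb Z}=(X_t,Y_t)_{t\in\mathbb Z}$ be a strictly stationary process with values in a product $\mathcal X\times\mathcal Y$ of measurable spaces. For $a\in\mathbb N$ let $$\beta(a)=\big\|\mathbb P_{-\infty:0,\,a:\infty}-\mathbb P_{-\infty:0}\otimes\mathbb P_{a:\infty}\big\|_{\mathrm{TV}},$$ where $\mathbb P_{-\infty:0}$, $\mathbb P_{a:\infty}$ and $\mathbb P_{-\infty:0,\,a:\infty}$ are the laws of $(Z_t)_{t\le 0}$, of $(Z_t)_{t\ge a}$ and of the two jointly, and $\|P-Q\|_{\mathrm{TV}}=\sup_S|P(S)-Q(S)|$ over measurable sets $S$. Suppose that the process is $\beta$-mixing, i.e. $\beta(a)\to0$ as $a\to\infty$. Split the sample $(X_i,Y_i)_{i=1}^n$, $n=n_{\mathrm{train}}+n_{\mathrm{cal}}+n_{\mathrm{test}}$, into consecutive index sets $I_{\mathrm{train}}=\{1,\dots,n_{\mathrm{train}}\}$, $I_{\mathrm{cal}}=\{n_{\mathrm{train}}+1,\dots,n_{\mathrm{train}}+n_{\mathrm{cal}}\}$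 and $I_{\mathrm{test}}=\{n_{\mathrm{train}}+n_{\mathrm{cal}}+1,\dots,n\}$. Let $s:(\mathcal X\times\mathcal Y)^{n_{\mathrm{train}}+1}\to\mathbb R$ be measurable, $\hat s_{\mathrm{train}}(x,y)=s\big((X_i,Y_i)_{i\in I_{\mathrm{train}}},(x,y)\big)$, and for $\alpha\in(0,1)$ put $$\hat q_{1-\alpha,\mathrm{cal}}=\inf\Big\{t\in\mathbb R:\tfrac1{n_{\mathrm{cal}}}\sum_{i\in I_{\mathrm{cal}}}\mathbf 1\{\hat s_{\mathrm{train}}(X_i,Y_i)\le t\}\ge1-\alpha\Big\},\qquad \mathcal C_{1-\alpha}(x)=\{y\in\mathcal Y:\hat s_{\mathrm{train}}(x,y)\le\hat q_{1-\alpha,\mathrm{cal}}\}.$$ For $\delta_{\mathrm{cal}}\in(0,1)$ let $$\mathcal F_{\mathrm{cal}}=\{(a,m,r)\in\mathbb N_{>0}^3:\ 2ma=n_{\mathrm{cal}}-r+1,\ \delta_{\mathrm{cal}}>4(m-1)\beta(a)+\beta(r)\},$$ suppose that $\mathcal F_{\mathrm{cal}}\neq\emptyset$ (otherwise the following infimum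 is $+\infty$ and nothing is claimed), and let $$\varepsilon_{\mathrm{cal}}=\inf_{(a,m,r)\in\mathcal F_{\mathrm{cal}}}\Big\{\tilde\sigma(a)\sqrt{\tfrac{4}{n_{\mathrm{cal}}-r+1}\,L(a,m,r)}+\tfrac1{3m}L(a,m,r)+\tfrac{r-1}{n_{\mathrm{cal}}}\Big\},$$ $$L(a,m,r)=\log\frac{4}{\delta_{\mathrm{cal}}-4(m-1)\beta(a)-\beta(r)},\qquad \tilde\sigma(a)=\sqrt{\tfrac14+\tfrac2a\sum_{k=1}^{a-1}(a-k)\beta(k)} .$$ Then for every $i\in I_{\mathrm{test}}$, with $\varepsilon_{\mathrm{train}}=\beta(i-n_{\mathrm{train}})$, $$\mathbb P\big[Y_i\in\mathcal C_{1-\alpha}(X_i)\big]\ \ge\ 1-\alpha-\big(\delta_{\mathrm{cal}}+\varepsilon_{\mathrm{train}}+\varepsilon_{\mathrm{cal}}\big).$$ Moreover, if $\mathbb P_{\mathrm{tr}}$ denotes conditional probability given $\sigma\big((X_j,Y_j)_{j\in I_{\mathrm{train}}}\big)$, then the expected shortfall of the conditional coverage satisfies $$\mathbb E\Big[\max\big\{0,\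 1-\alpha-\varepsilon_{\mathrm{cal}}-\mathbb P_{\mathrm{tr}}[Y_i\in\mathcal C_{1-\alpha}(X_i)]\big\}\Big]\ \le\ \delta_{\mathrm{cal}}+\varepsilon_{\mathrm{train}} .$$ -/

import Mathlib

open MeasureTheory ProbabilityTheory Filter Topology

noncomputable section

namespace ConformalMixing

/-- Total variation distance of two probability measures: `sup |P S - Q S|` over the measurable
sets `S`. -/
def tvDist {E : Type*} [MeasurableSpace E] (P Q : Measure E) : ℝ :=
  ⨆ S : {S : Set E // MeasurableSet S}, |P.real S - Q.real S|

section Mixing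

variable {Ω E : Type*} [MeasurableSpace Ω] [MeasurableSpace E]

/-- Strict stationarity: every time shift of the process has the same law on path space. -/
def IsStationary (μ : Measure Ω) (Z : ℤ → Ω → E) : Prop :=
  ∀ k : ℤ, μ.map (fun ω (t : ℤ) => Z (t + k) ω) = μ.map (fun ω (t : ℤ) => Z t ω)

/-- The past `(Z_t)_{t ≤ 0}`. -/
def past (Z : ℤ → Ω → E) (ω : Ω) : Set.Iic (0 : ℤ) → E := fun t => Z t ω

/-- The future `(Z_t)_{t ≥ a}`. -/
def future (Z : ℤ → Ω → E) (a : ℕ) (ω : Ω) : Set.Ici (a : ℤ) → E := fun t => Z t ω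

/-- The `β`-mixing coefficient at lag `a`: total variation distance between the joint law of
`(Z_t)_{t ≤ 0}` and `(Z_t)_{t ≥ a}` and the product of the two laws. -/
def betaCoeff (μ : Measure Ω) (Z : ℤ → Ω → E) (a : ℕ) : ℝ :=
  tvDist (μ.map fun ω => (past Z ω, future Z a ω))
    ((μ.map (past Z)).prod (μ.map (future Z a)))

/-- The process is `β`-mixing (absolutely regular). -/
def IsBetaMixing (μ : Measure Ω) (Z : ℤ → Ω → E) : Prop :=
  Tendsto (betaCoeff μ Z) atTop (𝓝 0)

end Mixing

section SplitConformal

variable {Ω 𝒳 𝒴 : Type*} [MeasurableSpace Ω] [MeasurableSpace 𝒳] [MeasurableSpace 𝒴]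

/-- The process of pairs `Z_t = (X_t, Y_t)`. -/
def pairs (X : ℤ → Ω → 𝒳) (Y : ℤ → Ω → 𝒴) (t : ℤ) (ω : Ω) : 𝒳 × 𝒴 := (X t ω, Y t ω)

/-- The training sample `(X_1, Y_1), …, (X_{nTrain}, Y_{nTrain})`. -/
def trainSample (X : ℤ → Ω → 𝒳) (Y : ℤ → Ω → 𝒴) (nTrain : ℕ) (ω : Ω) : Fin nTrain → 𝒳 × 𝒴 :=
  fun j => pairs X Y ((j : ℕ) + 1 : ℤ) ω

/-- The `σ`-algebra generated by the training sample. -/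
abbrev trainSigma (X : ℤ → Ω → 𝒳) (Y : ℤ → Ω → 𝒴) (nTrain : ℕ) : MeasurableSpace Ω :=
  MeasurableSpace.comap (trainSample X Y nTrain) inferInstance

/-- The trained score `ŝ_train(x, y) = s((X_i, Y_i)_{i ∈ I_train}, (x, y))`. -/
def trainedScore {nTrain : ℕ} (s : (Fin nTrain → 𝒳 × 𝒴) → 𝒳 × 𝒴 → ℝ)
    (X : ℤ → Ω → 𝒳) (Y : ℤ → Ω → 𝒴) (ω : Ω) (x : 𝒳) (y : 𝒴) : ℝ :=
  s (trainSample X Y nTrain ω) (x, y)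

/-- The empirical distribution function at `t` of the calibration scores, over
`I_cal = {nTrain + 1, …, nTrain + nCal}`. -/
def calCDF {nTrain : ℕ} (nCal : ℕ) (s : (Fin nTrain → 𝒳 × 𝒴) → 𝒳 × 𝒴 → ℝ)
    (X : ℤ → Ω → 𝒳) (Y : ℤ → Ω → 𝒴) (ω : Ω) (t : ℝ) : ℝ :=
  (1 / (nCal : ℝ)) * ∑ i ∈ Finset.Icc (nTrain + 1) (nTrain + nCal),
    Set.indicator {u : ℝ | u ≤ t} (fun _ => (1 : ℝ)) (trainedScore s X Y ω (X i ω) (Y i ω))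

/-- The empirical `(1 - α)`-quantile of the calibration scores. -/
def calQuantile {nTrain : ℕ} (nCal : ℕ) (s : (Fin nTrain → 𝒳 × 𝒴) → 𝒳 × 𝒴 → ℝ)
    (X : ℤ → Ω → 𝒳) (Y : ℤ → Ω → 𝒴) (α : ℝ) (ω : Ω) : ℝ :=
  sInf {t : ℝ | 1 - α ≤ calCDF nCal s X Y ω t}

/-- The split conformal prediction set `C_{1-α}(x) ⊆ 𝒴`. -/
def predictionSet {nTrain : ℕ} (nCal : ℕ) (s : (Fin nTrain → 𝒳 × 𝒴) → 𝒳 × 𝒴 → ℝ)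
    (X : ℤ → Ω → 𝒳) (Y : ℤ → Ω → 𝒴) (α : ℝ) (ω : Ω) (x : 𝒳) : Set 𝒴 :=
  {y | trainedScore s X Y ω x y ≤ calQuantile nCal s X Y α ω}

/-- The event `Y_i ∈ C_{1-α}(X_i)`. -/
def coverEvent {nTrain : ℕ} (nCal : ℕ) (s : (Fin nTrain → 𝒳 × 𝒴) → 𝒳 × 𝒴 → ℝ)
    (X : ℤ → Ω → 𝒳) (Y : ℤ → Ω → 𝒴) (α : ℝ) (i : ℕ) : Set Ω :=
  {ω | Y i ω ∈ predictionSet nCal s X Y α ω (X i ω)}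

end SplitConformal

section CalibrationBound

/-- `σ̃(a) = √(1/4 + (2/a) ∑_{k=1}^{a-1} (a - k) β(k))`. -/
def sigmaTilde (β : ℕ → ℝ) (a : ℕ) : ℝ :=
  Real.sqrt (1 / 4 + 2 / (a : ℝ) * ∑ k ∈ Finset.Ico 1 a, ((a : ℝ) - k) * β k)

/-- The admissible triples `(a, m, r)` of positive integers: `2ma = nCal - r + 1` and
`4(m - 1)β(a) + β(r) < δ`. -/
def feasible (β : ℕ → ℝ) (nCal : ℕ) (δ : ℝ) : Set (ℕ × ℕ × ℕ) :=
  {p | 0 < p.1 ∧ 0 < p.2.1 ∧ 0 < p.2.2 ∧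
    2 * (p.2.1 : ℤ) * p.1 = (nCal : ℤ) - p.2.2 + 1 ∧
    4 * ((p.2.1 : ℝ) - 1) * β p.1 + β p.2.2 < δ}

/-- The logarithmic factor `log (4 / (δ - 4(m - 1)β(a) - β(r)))`. -/
def logTerm (β : ℕ → ℝ) (δ : ℝ) (a m r : ℕ) : ℝ :=
  Real.log (4 / (δ - 4 * ((m : ℝ) - 1) * β a - β r))

/-- The deviation bound for one triple `(a, m, r)`. -/
def blockBound (β : ℕ → ℝ) (nCal : ℕ) (δ : ℝ) (a m r : ℕ) : ℝ :=
  sigmaTilde β a * Real.sqrt (4 / ((nCal : ℝ) - r + 1) * logTerm β δ a m r)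
    + 1 / (3 * (m : ℝ)) * logTerm β δ a m r
    + ((r : ℝ) - 1) / nCal

/-- `ε_cal`, the infimum of the deviation bound over the admissible triples. It is meant for a
nonempty set of triples; otherwise the infimum of the empty set is `+∞` in the usual convention. -/
def epsCal (β : ℕ → ℝ) (nCal : ℕ) (δ : ℝ) : ℝ :=
  sInf ((fun p : ℕ × ℕ × ℕ => blockBound β nCal δ p.1 p.2.1 p.2.2) '' feasible β nCal δ)

end CalibrationBound

end ConformalMixing

end

/-!
The point is to compare the calibration quantile `q̂` with a threshold `q` that depends on the
training sample only: put `c = 1 - α - ε_cal` and let `q` be the `c`-quantile of the score of a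
new observation, for a fixed training sample. The new observation is covered unless its score
exceeds `q` or `q̂ < q`.

*The new score.* For a fixed training sample the score is at most `q` with probability at least
`c`. Against the actual training sample, which ends `i - nTrain` steps earlier, the expected
shortfall of the conditional probability below `c` is an expectation over the event that there is
a shortfall. This event belongs to the training `σ`-algebra, so that the expectation is bounded by
the difference between the product law and the joint law of one measurable set, hence by
`β(i - nTrain)` (`integral_max_sub_condExp_le`).

*The calibration quantile.* If `q̂ < q`, then a fraction at least `1 - α` of the calibration scores
is below `q`, although a single one is so with probability at most `1 - α - ε_cal`. To bound the
probability of this deviation, drop the first `r - 1` calibration points, replace the others by a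
copy independent of the training sample at the price `β(r)`, and cut these `2ma` points into `2m`
blocks of length `a`. The odd blocks, and likewise the even ones, are separated by gaps of length
`a`. Chernoff's bound for their sum follows by induction on the number of blocks: splitting off the
first block costs `β(a)`, and the remaining tail probability may be integrated against the law of
the first block (`measureReal_le_alternatingSum`). As covariances of indicators are bounded by the
mixing coefficients, a block sum has variance at most `a σ̃(a) ^ 2`, and Bernstein's estimate of
its exponential moment gives the deviation in `ε_cal` (`measureReal_bernstein_le`,
`measureReal_calibration_deviation_le`). The failure probability is
`2 exp (-L) + 2 (m - 1) β(a) + β(r) ≤ δ_cal`.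

All decoupling goes through `abs_measureReal_sub_integral_le_betaCoeff`. Together these give the
bound on the expected shortfall of the conditional coverage; integrating `x ≤ max 0 x` turns it
into the bound on the marginal coverage.
-/

namespace ConformalMixing

/-! ### Decoupling across a gap -/


section Decoupling

variable {Ω E A B : Type*} [MeasurableSpace Ω] [MeasurableSpace E] [MeasurableSpace A]
  [MeasurableSpace B]

lemma abs_sub_le_tvDist (P Q : Measure E) [IsProbabilityMeasure P] [IsProbabilityMeasure Q]
    {S : Set E} (hS : MeasurableSet S) : |P.real S - Q.real S| ≤ tvDist P Q := by
  refine le_ciSup (f := fun S : {S : Set E // MeasurableSet S} => |P.real S - Q.real S|)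
    ⟨1, ?_⟩ ⟨S, hS⟩
  rintro _ ⟨T, rfl⟩
  exact abs_sub_le_of_nonneg_of_le measureReal_nonneg measureReal_le_one measureReal_nonneg
    measureReal_le_one

/-- The trajectory of the process, as a point of path space. -/
def path (Z : ℤ → Ω → E) (ω : Ω) : ℤ → E := fun t => Z t ω

variable {μ : Measure Ω} {Z : ℤ → Ω → E}

@[fun_prop]
lemma measurable_path (hZ : ∀ t, Measurable (Z t)) : Measurable (path Z) :=
  measurable_pi_lambda _ hZ

lemma betaCoeff_nonneg (a : ℕ) : 0 ≤ betaCoeff μ Z a :=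
  Real.iSup_nonneg fun _ => abs_nonneg _

lemma IsStationary.map_shift (hstat : IsStationary μ Z) (hZ : ∀ t, Measurable (Z t)) (k : ℤ)
    {F : (ℤ → E) → B} (hF : Measurable F) :
    μ.map (fun ω => F (path (fun t => Z (t + k)) ω)) = μ.map (fun ω => F (path Z ω)) := by
  have h1 := Measure.map_map (μ := μ) hF (measurable_path fun t => hZ (t + k))
  have h2 := Measure.map_map (μ := μ) hF (measurable_path hZ)
  have h3 : μ.map (path fun t => Z (t + k)) = μ.map (path Z) := hstat k
  rw [h3, h2] at h1
  exact h1.symm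

lemma IsStationary.map_eq (hstat : IsStationary μ Z) (hZ : ∀ t, Measurable (Z t)) (k : ℤ) :
    μ.map (Z k) = μ.map (Z 0) := by
  have h := hstat.map_shift hZ k (measurable_pi_apply (0 : ℤ))
  simpa [path] using h

/-- A statistic of the process up to time `k` and a statistic of the process from time `k + a` on
are independent up to an error `β(a)`, for every event about the two: on the right-hand side of
the difference the second one is computed on an independent copy `ω'` of the trajectory. -/
theorem abs_measureReal_sub_integral_le_betaCoeff [IsProbabilityMeasure μ]
    (hstat : IsStationary μ Z) (hZ : ∀ t, Measurable (Z t)) {k : ℤ} {a : ℕ}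
    {Φ : (ℤ → E) → A} (hΦ : Measurable Φ) (dΦ : DependsOn Φ (Set.Iic k))
    {Ψ : (ℤ → E) → B} (hΨ : Measurable Ψ) (dΨ : DependsOn Ψ (Set.Ici (k + a)))
    {S : Set (A × B)} (hS : MeasurableSet S) :
    |μ.real {ω | (Φ (path Z ω), Ψ (path Z ω)) ∈ S}
      - ∫ ω, μ.real {ω' | (Φ (path Z ω), Ψ (path Z ω')) ∈ S} ∂μ| ≤ betaCoeff μ Z a := by
  -- Shift time by `k`, so that `Φ` and `Ψ` factor through `past` and `future`.
  let W : ℤ → Ω → E := fun t => Z (t + k)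
  have hW : ∀ t, Measurable (W t) := fun t => hZ _
  let φ : (Set.Iic (0 : ℤ) → E) → A :=
    fun x => Φ fun t => x ⟨min (t - k) 0, Set.mem_Iic.2 (min_le_right _ _)⟩
  let ψ : (Set.Ici (a : ℤ) → E) → B :=
    fun x => Ψ fun t => x ⟨max (t - k) a, Set.mem_Ici.2 (le_max_right _ _)⟩
  have hφ : Measurable φ := hΦ.comp (measurable_pi_lambda _ fun t => measurable_pi_apply _)
  have hψ : Measurable ψ := hΨ.comp (measurable_pi_lambda _ fun t => measurable_pi_apply _)
  have eφ : ∀ ω, φ (past W ω) = Φ (path Z ω) := by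
    intro ω
    refine dΦ fun t ht => ?_
    have : min (t - k) 0 + k = t := by
      rw [min_eq_left (by simpa using ht)]; ring
    simp only [past, W, path, this]
  have eψ : ∀ ω, ψ (future W a ω) = Ψ (path Z ω) := by
    intro ω
    refine dΨ fun t ht => ?_
    have : max (t - k) a + k = t := by
      rw [max_eq_left (by have : k + a ≤ t := ht; linarith)]; ring
    simp only [future, W, path, this]
  have mpast : Measurable (past W) := measurable_pi_lambda _ fun t => hW _
  have mfut : Measurable (future W a) := measurable_pi_lambda _ fun t => hW _
  have mp : Measurable (fun (x : ℤ → E) (t : Set.Iic (0 : ℤ)) => x t) :=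
    measurable_pi_lambda _ fun t => measurable_pi_apply _
  have mf : Measurable (fun (x : ℤ → E) (t : Set.Ici (a : ℤ)) => x t) :=
    measurable_pi_lambda _ fun t => measurable_pi_apply _
  have e1 : μ.map (fun ω => (past W ω, future W a ω))
      = μ.map (fun ω => (past Z ω, future Z a ω)) := hstat.map_shift hZ k (mp.prodMk mf)
  have e2 : μ.map (past W) = μ.map (past Z) := hstat.map_shift hZ k mp
  have e3 : μ.map (future W a) = μ.map (future Z a) := hstat.map_shift hZ k mf
  let T : Set ((Set.Iic (0 : ℤ) → E) × (Set.Ici (a : ℤ) → E)) := Prod.map φ ψ ⁻¹' S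
  have hT : MeasurableSet T := (hφ.prodMap hψ) hS
  have := Measure.isProbabilityMeasure_map (μ := μ) mpast.aemeasurable
  have := Measure.isProbabilityMeasure_map (μ := μ) mfut.aemeasurable
  have := Measure.isProbabilityMeasure_map (μ := μ) (mpast.prodMk mfut).aemeasurable
  have key := abs_sub_le_tvDist (μ.map (fun ω => (past W ω, future W a ω)))
    ((μ.map (past W)).prod (μ.map (future W a))) hT
  have j1 : (μ.map (fun ω => (past W ω, future W a ω))).real T
      = μ.real {ω | (Φ (path Z ω), Ψ (path Z ω)) ∈ S} := by
    rw [map_measureReal_apply (mpast.prodMk mfut) hT]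
    congr 1
    ext ω
    simp [T, eφ, eψ]
  have j2 : ((μ.map (past W)).prod (μ.map (future W a))).real T
      = ∫ ω, μ.real {ω' | (Φ (path Z ω), Ψ (path Z ω')) ∈ S} ∂μ := by
    have hm := measurable_measure_prodMk_left (ν := μ.map (future W a)) hT
    simp only [measureReal_def]
    have hx : ∀ ω, μ {ω' | (Φ (path Z ω), Ψ (path Z ω')) ∈ S}
        = μ.map (future W a) (Prod.mk (past W ω) ⁻¹' T) := by
      intro ω
      rw [Measure.map_apply mfut (measurable_prodMk_left hT)]
      congr 1
      ext ω'
      simp [T, eφ, eψ]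
    simp only [hx]
    have hm' : Measurable fun ω => μ.map (future W a) (Prod.mk (past W ω) ⁻¹' T) := hm.comp mpast
    rw [integral_toReal hm'.aemeasurable (ae_of_all _ fun _ => measure_lt_top _ _),
      Measure.prod_apply hT, lintegral_map hm mpast]
  rw [j1, j2, e1, e2, e3] at key
  exact key

end Decoupling

/-! ### Bernstein's exponential moment bound -/

section Bernstein

variable {Ω : Type*} [MeasurableSpace Ω] {μ : Measure Ω}

/-- The comparison of `exp x` with its Padé approximant `(6 + 4x + x²) / (6 - 2x)`, cleared of the
denominator. The difference of the two sides is convex and has a critical point at `0`. -/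
lemma exp_mul_le (x : ℝ) : Real.exp x * (6 - 2 * x) ≤ 6 + 4 * x + x ^ 2 := by
  let g' : ℝ → ℝ := fun x => 4 + 2 * x - Real.exp x * (4 - 2 * x)
  let g : ℝ → ℝ := fun x => 6 + 4 * x + x ^ 2 - Real.exp x * (6 - 2 * x)
  have hg' : ∀ x, HasDerivAt g' (2 * (1 - Real.exp x * (1 - x))) x := by
    intro x
    have h := (((hasDerivAt_id x).const_mul 2).const_add 4).sub
      ((Real.hasDerivAt_exp x).mul (((hasDerivAt_id x).const_mul 2).const_sub 4))
    refine h.congr_deriv ?_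
    simp only [id]; ring
  have hg : ∀ x, HasDerivAt g (g' x) x := by
    intro x
    have h := ((((hasDerivAt_id x).const_mul 4).const_add 6).add (hasDerivAt_pow 2 x)).sub
      ((Real.hasDerivAt_exp x).mul (((hasDerivAt_id x).const_mul 2).const_sub 6))
    refine h.congr_deriv ?_
    simp only [id, g']; ring
  have mono : Monotone g' := monotone_of_hasDerivAt_nonneg hg' fun x => by
    have h1 : Real.exp x * (1 - x) ≤ Real.exp x * Real.exp (-x) := by
      gcongr; linarith [Real.add_one_le_exp (-x)]
    rw [← Real.exp_add, add_neg_cancel, Real.exp_zero] at h1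
    simp only [Pi.zero_apply]; linarith
  have hconv : ConvexOn ℝ Set.univ g := by
    refine MonotoneOn.convexOn_of_deriv convex_univ
      (fun x _ => (hg x).continuousAt.continuousWithinAt)
      (fun x _ => (hg x).differentiableAt.differentiableWithinAt) ?_
    have : deriv g = g' := funext fun x => (hg x).deriv
    rw [this]
    exact mono.monotoneOn _
  have h0 : g' 0 = 0 := by simp [g']
  have hmin : IsMinOn g Set.univ 0 := by
    refine hconv.isMinOn_of_rightDeriv_eq_zero (by simp) ?_
    rw [((hg 0).hasDerivWithinAt).derivWithin (uniqueDiffWithinAt_Ioi 0), h0]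
  have := hmin (Set.mem_univ x)
  simp [g] at this
  linarith

/-- The second-order remainder of the exponential is at most `x² / 2` times `1 / (1 - b / 3)`, for
`x` of either sign. -/
lemma exp_le_of_le {x b : ℝ} (hb : b < 3) (hx : x ≤ b) :
    Real.exp x ≤ 1 + x + x ^ 2 / (2 * (1 - b / 3)) := by
  have h1 := exp_mul_le x
  have h2 : Real.exp x ≤ 1 + x + x ^ 2 / (2 * (1 - x / 3)) := by
    have hx3 : 0 < 6 - 2 * x := by linarith
    have hx4 : 1 - x / 3 ≠ 0 := by intro h; linarith
    rw [← le_div_iff₀ hx3] at h1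
    refine h1.trans_eq ?_
    have hx5 : 3 - x ≠ 0 := by intro h; linarith
    have e1 : 6 - 2 * x = 2 * (3 - x) := by ring
    have e2 : 1 - x / 3 = (3 - x) / 3 := by ring
    rw [e1, e2]
    field_simp
    ring
  refine h2.trans ?_
  gcongr
  linarith

/-- Bernstein's bound on the exponential moment of a centred variable which is bounded by `b` and
has second moment at most `v`. -/
lemma mgf_le_exp [IsProbabilityMeasure μ] {X : Ω → ℝ} (hX : Measurable X) {b v l : ℝ}
    (hXb : ∀ ω, |X ω| ≤ b) (h0 : ∫ ω, X ω ∂μ = 0) (hv : ∫ ω, X ω ^ 2 ∂μ ≤ v) (hl : 0 ≤ l)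
    (hlb : l * b < 3) :
    mgf X μ l ≤ Real.exp (l ^ 2 * v / (2 * (1 - l * b / 3))) := by
  have hb : 0 ≤ b := by
    obtain ⟨ω⟩ : Nonempty Ω := nonempty_of_isProbabilityMeasure μ
    exact (abs_nonneg _).trans (hXb ω)
  have hD : 0 < 2 * (1 - l * b / 3) := by linarith
  have iX : Integrable X μ :=
    .of_bound hX.aestronglyMeasurable b (ae_of_all _ hXb)
  have iX2 : Integrable (fun ω => X ω ^ 2) μ :=
    .of_bound (hX.pow_const 2).aestronglyMeasurable (b ^ 2) (ae_of_all _ fun ω => by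
      rw [norm_pow]; exact pow_le_pow_left₀ (norm_nonneg _) (hXb ω) 2)
  have ile : ∀ ω, Real.exp (l * X ω)
      ≤ 1 + l * X ω + l ^ 2 / (2 * (1 - l * b / 3)) * X ω ^ 2 := by
    intro ω
    have h := exp_le_of_le (x := l * X ω) hlb
      (mul_le_mul_of_nonneg_left ((le_abs_self _).trans (hXb ω)) hl)
    refine h.trans_eq ?_
    ring
  have iexp : Integrable (fun ω => Real.exp (l * X ω)) μ :=
    .of_bound (by fun_prop) (Real.exp (l * b)) (ae_of_all _ fun ω => by
      rw [Real.norm_eq_abs, Real.abs_exp]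
      exact Real.exp_le_exp.2 (mul_le_mul_of_nonneg_left ((le_abs_self _).trans (hXb ω)) hl))
  calc mgf X μ l
      ≤ ∫ ω, (1 + l * X ω + l ^ 2 / (2 * (1 - l * b / 3)) * X ω ^ 2) ∂μ :=
        integral_mono iexp (((integrable_const _).add (iX.const_mul _)).add (iX2.const_mul _)) ile
    _ = 1 + l ^ 2 / (2 * (1 - l * b / 3)) * ∫ ω, X ω ^ 2 ∂μ := by
        have i1 : Integrable (fun ω => 1 + l * X ω) μ := (integrable_const _).add (iX.const_mul _)
        rw [integral_add i1 (iX2.const_mul _),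
          integral_add (integrable_const _) (iX.const_mul _), integral_const_mul,
          integral_const_mul, h0]
        simp
    _ ≤ 1 + l ^ 2 * v / (2 * (1 - l * b / 3)) := by
        have : l ^ 2 / (2 * (1 - l * b / 3)) * ∫ ω, X ω ^ 2 ∂μ
            ≤ l ^ 2 / (2 * (1 - l * b / 3)) * v := by gcongr
        linarith [this.trans_eq (div_mul_eq_mul_div _ _ _)]
    _ ≤ _ := by linarith [Real.add_one_le_exp (l ^ 2 * v / (2 * (1 - l * b / 3)))]

/-- Optimization of the Chernoff exponent: with `V u ^ 2 = 2 L`, the parameter `u / (1 + c u)`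
turns Bernstein's exponential moment into the deviation `√(2 V L) + c L`. -/
lemma exists_chernoff_parameter {V c L : ℝ} (hV : 0 < V) (hc : 0 ≤ c) (hL : 0 ≤ L) :
    ∃ l : ℝ, 0 ≤ l ∧ l * c < 1 ∧
      l ^ 2 * V / (2 * (1 - l * c)) - l * (Real.sqrt (2 * V * L) + c * L) = -L := by
  obtain ⟨u, hu, rfl⟩ : ∃ u : ℝ, 0 ≤ u ∧ V * u ^ 2 / 2 = L := by
    refine ⟨Real.sqrt (2 * L / V), Real.sqrt_nonneg _, ?_⟩
    rw [Real.sq_sqrt (by positivity)]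
    field_simp
  have hD : 0 < 1 + c * u := by positivity
  have hs : Real.sqrt (2 * V * (V * u ^ 2 / 2)) = V * u := by
    rw [show 2 * V * (V * u ^ 2 / 2) = (V * u) ^ 2 by ring]
    exact Real.sqrt_sq (by positivity)
  refine ⟨u / (1 + c * u), by positivity, ?_, ?_⟩
  · rw [div_mul_eq_mul_div, div_lt_one hD]; linarith
  · have h1 : 1 - u / (1 + c * u) * c = 1 / (1 + c * u) := by field_simp; ring
    rw [hs, h1]
    field_simp
    ring

end Bernstein

/-! ### Sums over blocks of a mixing sequence -/

section Blocks

variable {E : Type*}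

/-- The indicator of `A` minus a constant `p`, which is meant to be the probability of `A`. -/
noncomputable def centredIndicator (A : Set E) (p : ℝ) (x : E) : ℝ :=
  A.indicator (fun _ => (1 : ℝ)) x - p

/-- The sum of `g` over the block of `a` consecutive times starting at `N`. -/
noncomputable def blockSum (g : E → ℝ) (N : ℤ) (a : ℕ) (x : ℤ → E) : ℝ :=
  ∑ j ∈ Finset.range a, g (x (N + j))

/-- The sum of `g` over `m` blocks of length `a`, the first of which starts at `N`; consecutive
blocks are separated by gaps of length `a`. -/
noncomputable def alternatingSum (g : E → ℝ) (N : ℤ) (a m : ℕ) (x : ℤ → E) : ℝ :=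
  ∑ j ∈ Finset.range m, blockSum g (N + 2 * j * a) a x

lemma blockSum_succ (g : E → ℝ) (N : ℤ) (a : ℕ) (x : ℤ → E) :
    blockSum g N (a + 1) x = blockSum g N a x + g (x (N + a)) :=
  Finset.sum_range_succ _ _

lemma alternatingSum_succ (g : E → ℝ) (N : ℤ) (a m : ℕ) (x : ℤ → E) :
    alternatingSum g N a (m + 1) x = blockSum g N a x + alternatingSum g (N + 2 * a) a m x := by
  rw [alternatingSum, Finset.sum_range_succ', add_comm, alternatingSum]
  congr 1
  · simp
  · refine Finset.sum_congr rfl fun j _ => ?_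
    congr 1
    push_cast
    ring

lemma sum_range_eq_alternatingSum (g : E → ℝ) (N : ℤ) (a m : ℕ) (x : ℤ → E) :
    ∑ j ∈ Finset.range (2 * m * a), g (x (N + j))
      = alternatingSum g N a m x + alternatingSum g (N + a) a m x := by
  induction m with
  | zero => simp [alternatingSum]
  | succ m ih =>
    rw [show 2 * (m + 1) * a = 2 * m * a + a + a by ring, Finset.sum_range_add,
      Finset.sum_range_add, ih]
    simp only [alternatingSum, Finset.sum_range_succ, blockSum]
    have h1 : ∀ j : ℕ, N + ((2 * m * a + j : ℕ) : ℤ) = N + 2 * m * a + j := by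
      intro j; push_cast; ring
    have h2 : ∀ j : ℕ, N + ((2 * m * a + a + j : ℕ) : ℤ) = N + a + 2 * m * a + j := by
      intro j; push_cast; ring
    simp only [h1, h2]
    ring

lemma dependsOn_blockSum (g : E → ℝ) (N : ℤ) (a : ℕ) :
    DependsOn (blockSum g N a) (Set.Icc N (N + a)) := by
  intro x y h
  refine Finset.sum_congr rfl fun j hj => ?_
  rw [Finset.mem_range] at hj
  rw [h _ ⟨by lia, by lia⟩]

lemma dependsOn_alternatingSum (g : E → ℝ) (N : ℤ) (a m : ℕ) :
    DependsOn (alternatingSum g N a m) (Set.Ici N) := by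
  intro x y h
  refine Finset.sum_congr rfl fun j _ => dependsOn_blockSum g _ _ fun i hi => h i ?_
  have : (0 : ℤ) ≤ 2 * j * a := by positivity
  exact Set.mem_Ici.2 (by linarith [hi.1])

lemma abs_centredIndicator_le (A : Set E) {p : ℝ} (h0 : 0 ≤ p) (h1 : p ≤ 1) (x : E) :
    |centredIndicator A p x| ≤ 1 := by
  unfold centredIndicator
  by_cases hx : x ∈ A <;> simp only [hx, Set.indicator_of_mem, Set.indicator_of_notMem,
    not_false_eq_true] <;> rw [abs_le] <;> constructor <;> linarith

lemma abs_blockSum_le {g : E → ℝ} (hg : ∀ x, |g x| ≤ 1) (N : ℤ) (a : ℕ) (x : ℤ → E) :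
    |blockSum g N a x| ≤ a := by
  refine (Finset.abs_sum_le_sum_abs _ _).trans ?_
  refine (Finset.sum_le_sum fun j _ => hg _).trans ?_
  simp

end Blocks

section BlockDeviation

variable {Ω E : Type*} [MeasurableSpace Ω] [MeasurableSpace E] {μ : Measure Ω} {Z : ℤ → Ω → E}

@[fun_prop]
lemma measurable_blockSum {g : E → ℝ} (hg : Measurable g) (N : ℤ) (a : ℕ) :
    Measurable (blockSum g N a) :=
  Finset.measurable_fun_sum _ fun _ _ => hg.comp (measurable_pi_apply _)

@[fun_prop]
lemma measurable_alternatingSum {g : E → ℝ} (hg : Measurable g) (N : ℤ) (a m : ℕ) :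
    Measurable (alternatingSum g N a m) :=
  Finset.measurable_fun_sum _ fun _ _ => measurable_blockSum hg _ _

lemma measurable_centredIndicator {A : Set E} (hA : MeasurableSet A) (p : ℝ) :
    Measurable (centredIndicator A p) :=
  (measurable_const.indicator hA).sub_const p

lemma IsStationary.measureReal_preimage_eq (hstat : IsStationary μ Z)
    (hZ : ∀ t, Measurable (Z t)) {A : Set E} (hA : MeasurableSet A) (t : ℤ) :
    μ.real (Z t ⁻¹' A) = μ.real (Z 0 ⁻¹' A) := by
  rw [← map_measureReal_apply (hZ t) hA, hstat.map_eq hZ t, map_measureReal_apply (hZ 0) hA]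

lemma sq_sigmaTilde {a : ℕ} : sigmaTilde (betaCoeff μ Z) a ^ 2
    = 1 / 4 + 2 / (a : ℝ) * ∑ k ∈ Finset.Ico 1 a, ((a : ℝ) - k) * betaCoeff μ Z k := by
  refine Real.sq_sqrt ?_
  have : 0 ≤ ∑ k ∈ Finset.Ico 1 a, ((a : ℝ) - k) * betaCoeff μ Z k :=
    Finset.sum_nonneg fun k hk => mul_nonneg
      (sub_nonneg.2 (by exact_mod_cast (Finset.mem_Ico.1 hk).2.le)) (betaCoeff_nonneg k)
  positivity

variable [IsProbabilityMeasure μ]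

lemma measureReal_inter_sub_le_betaCoeff (hstat : IsStationary μ Z) (hZ : ∀ t, Measurable (Z t))
    {A : Set E} (hA : MeasurableSet A) (t : ℤ) (k : ℕ) :
    μ.real (Z t ⁻¹' A ∩ Z (t + k) ⁻¹' A) - μ.real (Z t ⁻¹' A) * μ.real (Z (t + k) ⁻¹' A)
      ≤ betaCoeff μ Z k := by
  have h := abs_measureReal_sub_integral_le_betaCoeff hstat hZ (k := t) (a := k)
    (Φ := fun x => x t) (measurable_pi_apply _) (fun x y h => h t (by simp))
    (Ψ := fun x => x (t + k)) (measurable_pi_apply _) (fun x y h => h _ (by simp))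
    (hA.prod hA)
  have e : ∀ ω, μ.real {ω' | (path Z ω t, path Z ω' (t + k)) ∈ A ×ˢ A}
      = (Z t ⁻¹' A).indicator (fun _ => μ.real (Z (t + k) ⁻¹' A)) ω := by
    intro ω
    by_cases hω : Z t ω ∈ A
    · simp [path, hω, Set.preimage]
    · simp [path, hω]
  simp only [e] at h
  rw [integral_indicator_const _ (hZ t hA), smul_eq_mul] at h
  exact (le_abs_self _).trans h

lemma integral_centredIndicator (hstat : IsStationary μ Z) (hZ : ∀ t, Measurable (Z t))
    {A : Set E} (hA : MeasurableSet A) (t : ℤ) :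
    ∫ ω, centredIndicator A (μ.real (Z 0 ⁻¹' A)) (Z t ω) ∂μ = 0 := by
  have e : ∀ ω, centredIndicator A (μ.real (Z 0 ⁻¹' A)) (Z t ω)
      = (Z t ⁻¹' A).indicator (fun _ => (1 : ℝ)) ω - μ.real (Z 0 ⁻¹' A) := fun ω => rfl
  simp only [e]
  rw [integral_sub ((integrable_const _).indicator (hZ t hA)) (integrable_const _),
    integral_indicator_const _ (hZ t hA), hstat.measureReal_preimage_eq hZ hA t]
  simp

lemma integral_centredIndicator_mul (hstat : IsStationary μ Z) (hZ : ∀ t, Measurable (Z t))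
    {A : Set E} (hA : MeasurableSet A) (t u : ℤ) :
    ∫ ω, centredIndicator A (μ.real (Z 0 ⁻¹' A)) (Z t ω)
        * centredIndicator A (μ.real (Z 0 ⁻¹' A)) (Z u ω) ∂μ
      = μ.real (Z t ⁻¹' A ∩ Z u ⁻¹' A) - μ.real (Z 0 ⁻¹' A) ^ 2 := by
  set p := μ.real (Z 0 ⁻¹' A)
  have e : ∀ ω, centredIndicator A p (Z t ω) * centredIndicator A p (Z u ω)
      = (Z t ⁻¹' A ∩ Z u ⁻¹' A).indicator (fun _ => (1 : ℝ)) ω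
        - p * centredIndicator A p (Z t ω) - p * centredIndicator A p (Z u ω) - p ^ 2 := by
    intro ω
    by_cases h1 : Z t ω ∈ A <;> by_cases h2 : Z u ω ∈ A <;>
      simp [centredIndicator, h1, h2] <;> ring
  have i0 : ∀ t, Integrable (fun ω => centredIndicator A p (Z t ω)) μ := fun t =>
    ((integrable_const (1 : ℝ)).indicator (hZ t hA)).sub (integrable_const p)
  have i1 : Integrable ((Z t ⁻¹' A ∩ Z u ⁻¹' A).indicator fun _ => (1 : ℝ)) μ :=
    (integrable_const _).indicator ((hZ t hA).inter (hZ u hA))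
  have i2 := i1.sub ((i0 t).const_mul p)
  have i3 := i2.sub ((i0 u).const_mul p)
  simp only [e]
  refine (integral_sub i3 (integrable_const _)).trans ?_
  rw [integral_sub' i2 ((i0 u).const_mul p), integral_sub' i1 ((i0 t).const_mul p),
    integral_indicator_const _ ((hZ t hA).inter (hZ u hA)), integral_const_mul,
    integral_const_mul, integral_centredIndicator hstat hZ hA,
    integral_centredIndicator hstat hZ hA]
  simp

/-- The variance of a block sum: the diagonal terms are at most `1 / 4` each, and the covariance
of two indicators at distance `k` is at most `β(k)`. -/
lemma integral_blockSum_sq_le (hstat : IsStationary μ Z) (hZ : ∀ t, Measurable (Z t))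
    {A : Set E} (hA : MeasurableSet A) (N : ℤ) (a : ℕ) :
    ∫ ω, blockSum (centredIndicator A (μ.real (Z 0 ⁻¹' A))) N a (path Z ω) ^ 2 ∂μ
      ≤ a / 4 + 2 * ∑ k ∈ Finset.Ico 1 a, ((a : ℝ) - k) * betaCoeff μ Z k := by
  set p := μ.real (Z 0 ⁻¹' A) with hp
  have hp0 : 0 ≤ p := measureReal_nonneg
  have hp1 : p ≤ 1 := measureReal_le_one
  set g := centredIndicator A p with hg
  have mg : Measurable g := measurable_centredIndicator hA p
  have bg : ∀ x, |g x| ≤ 1 := abs_centredIndicator_le A hp0 hp1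
  have mgZ : ∀ t, Measurable fun ω => g (Z t ω) := fun t => mg.comp (hZ t)
  have imul : ∀ t u, Integrable (fun ω => g (Z t ω) * g (Z u ω)) μ := fun t u =>
    .of_bound ((mgZ t).mul (mgZ u)).aestronglyMeasurable 1 (ae_of_all _ fun ω => by
      rw [norm_mul]
      exact mul_le_one₀ (bg _) (norm_nonneg _) (bg _))
  have hdiag : ∀ t, ∫ ω, g (Z t ω) * g (Z t ω) ∂μ ≤ 1 / 4 := by
    intro t
    rw [hg, hp, integral_centredIndicator_mul hstat hZ hA, Set.inter_self,
      hstat.measureReal_preimage_eq hZ hA t, ← hp]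
    nlinarith [sq_nonneg (p - 1 / 2)]
  have hoff : ∀ (t : ℤ) (k : ℕ), ∫ ω, g (Z t ω) * g (Z (t + k) ω) ∂μ ≤ betaCoeff μ Z k := by
    intro t k
    rw [hg, hp, integral_centredIndicator_mul hstat hZ hA]
    have := measureReal_inter_sub_le_betaCoeff hstat hZ hA t k
    rw [hstat.measureReal_preimage_eq hZ hA t, hstat.measureReal_preimage_eq hZ hA (t + k)] at this
    rwa [sq]
  induction a with
  | zero => simp [blockSum]
  | succ a ih =>
    have e : ∀ ω, blockSum g N (a + 1) (path Z ω) ^ 2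
        = blockSum g N a (path Z ω) ^ 2
          + 2 * ∑ j ∈ Finset.range a, g (Z (N + j) ω) * g (Z (N + a) ω)
          + g (Z (N + a) ω) * g (Z (N + a) ω) := by
      intro ω
      rw [blockSum_succ, ← Finset.sum_mul]
      simp only [blockSum, path]
      ring
    have i1 : Integrable (fun ω => blockSum g N a (path Z ω) ^ 2) μ :=
      .of_bound (((measurable_blockSum mg N a).comp (measurable_path hZ)).pow_const
        2).aestronglyMeasurable ((a : ℝ) ^ 2) (ae_of_all _ fun ω => by
          rw [norm_pow]
          exact pow_le_pow_left₀ (norm_nonneg _) (abs_blockSum_le bg _ _ _) 2)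
    have i2 : Integrable
        (fun ω => 2 * ∑ j ∈ Finset.range a, g (Z (N + j) ω) * g (Z (N + a) ω)) μ :=
      (integrable_finsetSum _ fun j _ => imul _ _).const_mul _
    have i12 : Integrable (fun ω => blockSum g N a (path Z ω) ^ 2
        + 2 * ∑ j ∈ Finset.range a, g (Z (N + j) ω) * g (Z (N + a) ω)) μ := i1.add i2
    simp only [e]
    rw [integral_add i12 (imul _ _), integral_add i1 i2, integral_const_mul,
      integral_finsetSum _ fun j _ => imul _ _]
    have hcross : ∑ j ∈ Finset.range a, ∫ ω, g (Z (N + j) ω) * g (Z (N + a) ω) ∂μ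
        ≤ ∑ k ∈ Finset.Ico 1 (a + 1), betaCoeff μ Z k := by
      have hr : ∑ k ∈ Finset.Ico 1 (a + 1), betaCoeff μ Z k
          = ∑ j ∈ Finset.range a, betaCoeff μ Z (a - j) := by
        rw [Finset.range_eq_Ico, Finset.sum_Ico_reflect _ _ (Nat.le_succ a)]
        simp
      rw [hr]
      refine Finset.sum_le_sum fun j hj => ?_
      have hja := Finset.mem_range.1 hj
      have h := hoff (N + j) (a - j)
      rwa [show (N + j : ℤ) + ((a - j : ℕ) : ℤ) = N + a by
        rw [Nat.cast_sub hja.le]; ring] at h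
    have hsum : ∑ k ∈ Finset.Ico 1 (a + 1), (((a + 1 : ℕ) : ℝ) - k) * betaCoeff μ Z k
        = ∑ k ∈ Finset.Ico 1 a, ((a : ℝ) - k) * betaCoeff μ Z k
          + ∑ k ∈ Finset.Ico 1 (a + 1), betaCoeff μ Z k := by
      have : ∑ k ∈ Finset.Ico 1 a, ((a : ℝ) - k) * betaCoeff μ Z k
          = ∑ k ∈ Finset.Ico 1 (a + 1), ((a : ℝ) - k) * betaCoeff μ Z k := by
        rcases Nat.eq_zero_or_pos a with rfl | ha
        · simp
        · rw [Finset.sum_Ico_succ_top ha]; simp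
      rw [this, ← Finset.sum_add_distrib]
      refine Finset.sum_congr rfl fun k _ => ?_
      push_cast
      ring
    rw [hsum]
    push_cast
    linarith [hdiag (N + a)]

/-- Chernoff's bound for sums over separated blocks. Each block but one is decoupled from the
later ones at the price `β(a)`; on the decoupled event the exponential moments multiply. -/
lemma measureReal_le_alternatingSum (hstat : IsStationary μ Z) (hZ : ∀ t, Measurable (Z t))
    {g : E → ℝ} (hg : Measurable g) (bg : ∀ x, |g x| ≤ 1) {a : ℕ} {l M : ℝ} (hl : 0 ≤ l)
    (hM : ∀ N, mgf (fun ω => blockSum g N a (path Z ω)) μ l ≤ M)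
    (m : ℕ) (N : ℤ) (T : ℝ) :
    μ.real {ω | T ≤ alternatingSum g N a (m + 1) (path Z ω)}
      ≤ Real.exp (-l * T) * M ^ (m + 1) + m * betaCoeff μ Z a := by
  have mb : ∀ N, Measurable fun ω => blockSum g N a (path Z ω) := fun N =>
    (measurable_blockSum hg N a).comp (measurable_path hZ)
  have iexp : ∀ N, Integrable (fun ω => Real.exp (l * blockSum g N a (path Z ω))) μ := fun N =>
    .of_bound (((mb N).const_mul l).exp).aestronglyMeasurable (Real.exp (l * a))
      (ae_of_all _ fun ω => by
        rw [Real.norm_eq_abs, Real.abs_exp]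
        exact Real.exp_le_exp.2 (mul_le_mul_of_nonneg_left
          ((le_abs_self _).trans (abs_blockSum_le bg _ _ _)) hl))
  have hM0 : 0 ≤ M := mgf_nonneg.trans (hM 0)
  induction m generalizing N T with
  | zero =>
    have h := measure_ge_le_exp_mul_mgf T hl (iexp N)
    have h' : Real.exp (-l * T) * mgf (fun ω => blockSum g N a (path Z ω)) μ l
        ≤ Real.exp (-l * T) * M := by gcongr; exact hM N
    simpa [alternatingSum] using h.trans h'
  | succ m ih =>
    have mA := measurable_alternatingSum hg (N + 2 * a) a (m + 1)
    have h := abs_measureReal_sub_integral_le_betaCoeff hstat hZ (k := N + a) (a := a)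
      (measurable_blockSum hg N a)
      ((dependsOn_blockSum g N a).mono fun i hi => hi.2) mA
      ((dependsOn_alternatingSum g (N + 2 * a) a (m + 1)).mono fun i hi => by
        simp only [Set.mem_Ici] at hi ⊢; linarith)
      (S := {x : ℝ × ℝ | T ≤ x.1 + x.2}) (measurableSet_le measurable_const (by fun_prop))
    have h2 : ∫ ω, μ.real {ω' | (blockSum g N a (path Z ω),
          alternatingSum g (N + 2 * a) a (m + 1) (path Z ω')) ∈ {x : ℝ × ℝ | T ≤ x.1 + x.2}} ∂μ
        ≤ ∫ ω, (Real.exp (-l * T) * M ^ (m + 1) * Real.exp (l * blockSum g N a (path Z ω))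
          + m * betaCoeff μ Z a) ∂μ := by
      refine integral_mono_of_nonneg (ae_of_all _ fun ω => measureReal_nonneg)
        (((iexp N).const_mul _).add (integrable_const _)) (ae_of_all _ fun ω => ?_)
      have h3 := ih (N + 2 * a) (T - blockSum g N a (path Z ω))
      have e1 : Real.exp (-l * (T - blockSum g N a (path Z ω)))
          = Real.exp (-l * T) * Real.exp (l * blockSum g N a (path Z ω)) := by
        rw [← Real.exp_add]; congr 1; ring
      rw [e1] at h3
      simp only [Set.mem_ofPred_eq, ← sub_le_iff_le_add']
      linarith
    rw [integral_add ((iexp N).const_mul _) (integrable_const _), integral_const_mul] at h2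
    have h4 : Real.exp (-l * T) * M ^ (m + 1)
        * ∫ ω, Real.exp (l * blockSum g N a (path Z ω)) ∂μ
        ≤ Real.exp (-l * T) * M ^ (m + 1) * M := by gcongr; exact hM N
    simp only [alternatingSum_succ g N a (m + 1)]
    simp only [Set.mem_ofPred_eq] at h h2
    simp only [integral_const, probReal_univ, one_smul] at h2
    rw [pow_succ M (m + 1)]
    push_cast
    linarith [(abs_le.1 h).2]

/-- Bernstein's inequality for `m` separated blocks of length `a` of a `β`-mixing sequence of
indicators: a block has variance at most `a σ̃(a) ^ 2` and is bounded by `a`. -/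
theorem measureReal_bernstein_le (hstat : IsStationary μ Z) (hZ : ∀ t, Measurable (Z t))
    {A : Set E} (hA : MeasurableSet A) {a m : ℕ} (ha : 0 < a) (hm : 0 < m) {L : ℝ} (hL : 0 ≤ L)
    (N : ℤ) :
    μ.real {ω | Real.sqrt (2 * (m * (a * sigmaTilde (betaCoeff μ Z) a ^ 2)) * L) + a / 3 * L
        ≤ alternatingSum (centredIndicator A (μ.real (Z 0 ⁻¹' A))) N a m (path Z ω)}
      ≤ Real.exp (-L) + ((m : ℝ) - 1) * betaCoeff μ Z a := by
  obtain ⟨m, rfl⟩ : ∃ m', m = m' + 1 := ⟨m - 1, by lia⟩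
  set p := μ.real (Z 0 ⁻¹' A) with hp
  have mg := measurable_centredIndicator hA p
  have bg := abs_centredIndicator_le A (p := p) measureReal_nonneg measureReal_le_one
  set v : ℝ := a * sigmaTilde (betaCoeff μ Z) a ^ 2 with hv
  have haR : (0 : ℝ) < a := by exact_mod_cast ha
  have hv' : v = a / 4 + 2 * ∑ k ∈ Finset.Ico 1 a, ((a : ℝ) - k) * betaCoeff μ Z k := by
    rw [hv, sq_sigmaTilde]; field_simp
  have hv0 : 0 < v := by
    have : 0 ≤ ∑ k ∈ Finset.Ico 1 a, ((a : ℝ) - k) * betaCoeff μ Z k :=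
      Finset.sum_nonneg fun k hk => mul_nonneg
        (sub_nonneg.2 (by exact_mod_cast (Finset.mem_Ico.1 hk).2.le)) (betaCoeff_nonneg k)
    rw [hv']; positivity
  obtain ⟨l, hl, hlc, hlL⟩ := exists_chernoff_parameter (V := (m + 1 : ℕ) * v) (c := a / 3)
    (L := L) (by positivity) (by positivity) hL
  have hM : ∀ N, mgf (fun ω => blockSum (centredIndicator A p) N a (path Z ω)) μ l
      ≤ Real.exp (l ^ 2 * v / (2 * (1 - l * a / 3))) := by
    intro N
    refine mgf_le_exp (X := fun ω => blockSum (centredIndicator A p) N a (path Z ω))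
      ((measurable_blockSum mg N a).comp (measurable_path hZ))
      (fun ω => abs_blockSum_le bg _ _ _) ?_ ?_ hl (by linarith)
    · simp only [blockSum, path]
      rw [integral_finsetSum]
      · exact Finset.sum_eq_zero fun j _ => integral_centredIndicator hstat hZ hA _
      · exact fun j _ => .of_bound (mg.comp (hZ _)).aestronglyMeasurable 1
          (ae_of_all _ fun ω => bg _)
    · rw [hv']
      exact integral_blockSum_sq_le hstat hZ hA N a
  have h := measureReal_le_alternatingSum hstat hZ mg bg hl hM m N
    (Real.sqrt (2 * ((m + 1 : ℕ) * v) * L) + a / 3 * L)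
  rw [← Real.exp_nat_mul, ← Real.exp_add] at h
  refine h.trans_eq ?_
  congr 2
  · rw [← hlL, mul_div_assoc l (a : ℝ) 3]
    ring
  · push_cast; ring

end BlockDeviation

/-! ### Quantiles -/

section Quantile

/-- The lower `c`-quantile of a probability measure on the line; meaningful for `0 < c < 1`. -/
noncomputable def quantile (ρ : Measure ℝ) (c : ℝ) : ℝ := sInf {t | c ≤ ρ.real (Set.Iic t)}

variable {ρ : Measure ℝ} [IsProbabilityMeasure ρ] {c : ℝ}

lemma bddBelow_setOf_le_measureReal_Iic (h0 : 0 < c) :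
    BddBelow {t | c ≤ ρ.real (Set.Iic t)} := by
  obtain ⟨b, hb⟩ := ((tendsto_cdf_atBot ρ).eventually_lt_const h0).exists
  refine ⟨b, fun t ht => ?_⟩
  rw [cdf_eq_real] at hb
  by_contra! hlt
  have ht' : c ≤ ρ.real (Set.Iic t) := ht
  linarith [measureReal_mono (μ := ρ) (Set.Iic_subset_Iic.2 hlt.le)]

lemma nonempty_setOf_le_measureReal_Iic (h1 : c < 1) :
    {t | c ≤ ρ.real (Set.Iic t)}.Nonempty := by
  obtain ⟨b, hb⟩ := ((tendsto_cdf_atTop ρ).eventually_const_lt h1).exists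
  rw [cdf_eq_real] at hb
  exact ⟨b, hb.le⟩

/-- The quantile inequality: the infimum defining the quantile is attained, because the
distribution function is right continuous. -/
lemma le_measureReal_Iic_quantile (h1 : c < 1) :
    c ≤ ρ.real (Set.Iic (quantile ρ c)) := by
  have hr := ((cdf ρ).right_continuous (quantile ρ c)).mono Set.Ioi_subset_Ici_self
  rw [← cdf_eq_real]
  refine ge_of_tendsto hr ?_
  filter_upwards [self_mem_nhdsWithin] with t ht
  obtain ⟨u, hu, hut⟩ := exists_lt_of_csInf_lt (nonempty_setOf_le_measureReal_Iic h1) ht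
  rw [cdf_eq_real]
  exact le_trans hu (measureReal_mono (Set.Iic_subset_Iic.2 hut.le))

lemma quantile_le_iff (h0 : 0 < c) (h1 : c < 1) {t : ℝ} :
    quantile ρ c ≤ t ↔ c ≤ ρ.real (Set.Iic t) :=
  ⟨fun h => (le_measureReal_Iic_quantile h1).trans (measureReal_mono (Set.Iic_subset_Iic.2 h)),
    fun h => csInf_le (bddBelow_setOf_le_measureReal_Iic h0) h⟩

lemma measureReal_Iio_quantile_le (h0 : 0 < c) (h1 : c < 1) :
    ρ.real (Set.Iio (quantile ρ c)) ≤ c := by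
  have h := (cdf ρ).measure_Iio (tendsto_cdf_atBot ρ) (quantile ρ c)
  rw [measure_cdf, sub_zero] at h
  rw [measureReal_def, h]
  refine ENNReal.toReal_le_of_le_ofReal h0.le (ENNReal.ofReal_le_ofReal ?_)
  refine le_of_tendsto ((cdf ρ).mono.tendsto_leftLim _) ?_
  filter_upwards [self_mem_nhdsWithin] with t ht
  rw [cdf_eq_real]
  by_contra! hlt
  exact absurd ((quantile_le_iff h0 h1).2 hlt.le) (not_le.2 ht)

end Quantile

/-! ### Decoupling from the training sample -/

section Conditional

variable {Ω E D : Type*}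

/-- The first `n` observations of a trajectory, at times `1, …, n`. -/
def initialSample (n : ℕ) (x : ℤ → E) : Fin n → E := fun j => x ((j : ℕ) + 1 : ℤ)

lemma dependsOn_initialSample (n : ℕ) : DependsOn (initialSample (E := E) n) (Set.Iic (n : ℤ)) :=
  fun x y h => funext fun j => h _ (by have := j.isLt; simp only [Set.mem_Iic]; lia)

variable [MeasurableSpace Ω] [MeasurableSpace E] [MeasurableSpace D]

lemma measurable_quantile_map {ν : Measure E} [IsProbabilityMeasure ν] {s : D → E → ℝ}
    (hs : Measurable (Function.uncurry s)) {c : ℝ} (h0 : 0 < c) (h1 : c < 1) :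
    Measurable fun z => quantile (ν.map (s z)) c := by
  have hsz : ∀ z, Measurable (s z) := fun z => hs.comp measurable_prodMk_left
  refine measurable_of_Iic fun t => ?_
  have hm := (measurable_measure_prodMk_left (ν := ν)
    (hs (measurableSet_Iic (a := t)))).ennreal_toReal
  convert measurableSet_le (measurable_const (a := c)) hm using 1
  ext z
  have := Measure.isProbabilityMeasure_map (μ := ν) (hsz z).aemeasurable
  simp only [Set.mem_preimage, Set.mem_Iic, Set.mem_ofPred_eq]
  rw [quantile_le_iff h0 h1, map_measureReal_apply (hsz z) measurableSet_Iic]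
  rfl

variable {μ : Measure Ω} [IsProbabilityMeasure μ] {Z : ℤ → Ω → E}

lemma measurable_initialSample (n : ℕ) : Measurable (initialSample (E := E) n) :=
  measurable_pi_lambda _ fun _ => measurable_pi_apply _

/-- If, for a fixed training sample, the new observation falls into a section of `G` with
probability at least `c`, then the expected shortfall below `c` of the conditional probability of
this event given the actual training sample is at most the mixing coefficient. The shortfall is
integrated over an event `A` of the training `σ`-algebra, which makes it the difference between
the decoupled and the joint probability of a single event. -/
lemma integral_max_sub_condExp_le (hstat : IsStationary μ Z) (hZ : ∀ t, Measurable (Z t))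
    (n j : ℕ) {G : Set ((Fin n → E) × E)} (hG : MeasurableSet G) {c : ℝ}
    (hc : ∀ z, c ≤ μ.real {ω | (z, Z (n + j) ω) ∈ G}) :
    ∫ ω, max 0 (c - (μ⟦{ω | (initialSample n (path Z ω), Z (n + j) ω) ∈ G} |
        MeasurableSpace.comap (fun ω => initialSample n (path Z ω)) inferInstance⟧) ω) ∂μ
      ≤ betaCoeff μ Z j := by
  have mT : Measurable fun ω => initialSample n (path Z ω) :=
    (measurable_initialSample n).comp (measurable_path hZ)
  have hle : MeasurableSpace.comap (fun ω => initialSample n (path Z ω)) inferInstance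
      ≤ ‹MeasurableSpace Ω› :=
    mT.comap_le
  set V : Set Ω := {ω | (initialSample n (path Z ω), Z (n + j) ω) ∈ G} with hV
  have mV : MeasurableSet V := (mT.prodMk (hZ _)) hG
  have iV : Integrable (V.indicator fun _ => (1 : ℝ)) μ := (integrable_const _).indicator mV
  set P : Ω → ℝ :=
    μ⟦V | MeasurableSpace.comap (fun ω => initialSample n (path Z ω)) inferInstance⟧ with hP
  have hPm : Measurable[
      MeasurableSpace.comap (fun ω => initialSample n (path Z ω)) inferInstance] P :=
    stronglyMeasurable_condExp.measurable
  have mA : MeasurableSet[MeasurableSpace.comap (fun ω => initialSample n (path Z ω)) inferInstance]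
      {ω | P ω < c} := measurableSet_lt hPm measurable_const
  obtain ⟨A', mA', hA'⟩ := mA
  have mA0 : MeasurableSet {ω | P ω < c} := hle _ ⟨A', mA', hA'⟩
  have e1 : ∀ ω, max 0 (c - P ω) = {ω | P ω < c}.indicator (fun ω => c - P ω) ω := by
    intro ω
    by_cases h : P ω < c
    · rw [Set.indicator_of_mem (by exact h), max_eq_right (by linarith)]
    · rw [Set.indicator_of_notMem (by exact h), max_eq_left (by linarith)]
  simp only [e1]
  rw [integral_indicator mA0, integral_sub (integrable_const _) integrable_condExp.integrableOn,
    setIntegral_condExp hle iV ⟨A', mA', hA'⟩, setIntegral_const,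
    setIntegral_indicator mV, setIntegral_const]
  have key := abs_measureReal_sub_integral_le_betaCoeff hstat hZ (k := n) (a := j)
    (measurable_initialSample n) (dependsOn_initialSample n)
    (Ψ := fun x => x (n + j)) (measurable_pi_apply _) (fun x y h => h _ (by simp))
    (S := Prod.fst ⁻¹' A' ∩ G) ((measurable_fst mA').inter hG)
  have e2 : {ω | (initialSample n (path Z ω), path Z ω (n + j)) ∈ Prod.fst ⁻¹' A' ∩ G}
      = {ω | P ω < c} ∩ V := by
    rw [← hA']; rfl
  have h3 : ∫ ω, {ω | P ω < c}.indicator (fun _ => c) ω ∂μ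
      ≤ ∫ ω, μ.real {ω' | (initialSample n (path Z ω), path Z ω' (n + j))
          ∈ Prod.fst ⁻¹' A' ∩ G} ∂μ := by
    have hmeas := (measurable_measure_prodMk_left (ν := μ.map (Z (n + j)))
      ((measurable_fst mA').inter hG)).ennreal_toReal.comp mT
    have e4 : ∀ ω, μ.real {ω' | (initialSample n (path Z ω), path Z ω' (n + j))
          ∈ Prod.fst ⁻¹' A' ∩ G}
        = (μ.map (Z (n + j)) (Prod.mk (initialSample n (path Z ω)) ⁻¹'
          (Prod.fst ⁻¹' A' ∩ G))).toReal := by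
      intro ω
      rw [Measure.map_apply (hZ _) (measurable_prodMk_left ((measurable_fst mA').inter hG))]
      rfl
    refine integral_mono ((integrable_const c).indicator mA0) ?_ fun ω => ?_
    · refine .of_bound (C := 1) ?_ (ae_of_all _ fun ω => ?_)
      · simp only [e4]
        exact hmeas.aestronglyMeasurable
      · rw [Real.norm_eq_abs, abs_of_nonneg measureReal_nonneg]
        exact measureReal_le_one
    · by_cases h : P ω < c
      · rw [Set.indicator_of_mem (by exact h)]
        have hA : initialSample n (path Z ω) ∈ A' := by
          have : ω ∈ {ω | P ω < c} := h
          rw [← hA'] at this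
          exact this
        refine (hc (initialSample n (path Z ω))).trans (measureReal_mono fun ω' h' => ⟨hA, h'⟩)
      · rw [Set.indicator_of_notMem (by exact h)]
        exact measureReal_nonneg
  rw [integral_indicator_const _ mA0] at h3
  rw [e2] at key
  simp only [smul_eq_mul, mul_one] at h3 ⊢
  linarith [(abs_le.1 key).1]

/-- The deviation bound for the empirical frequency of the sections of `G` over `2 m a`
observations that start `r` steps after the training sample. The observations are decoupled from
the training sample at the price `β(r)`, then split into the odd and the even blocks. -/
lemma measureReal_calibration_deviation_le (hstat : IsStationary μ Z)
    (hZ : ∀ t, Measurable (Z t)) (n : ℕ) {a m : ℕ} (ha : 0 < a) (hm : 0 < m) (r : ℕ)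
    {L : ℝ} (hL : 0 ≤ L) {G : Set ((Fin n → E) × E)} (hG : MeasurableSet G) :
    μ.real {ω | 2 * m * a * μ.real {ω' | (initialSample n (path Z ω), Z 0 ω') ∈ G}
        + 2 * (Real.sqrt (2 * (m * (a * sigmaTilde (betaCoeff μ Z) a ^ 2)) * L) + a / 3 * L)
        ≤ ∑ j ∈ Finset.range (2 * m * a),
          G.indicator (fun _ => (1 : ℝ)) (initialSample n (path Z ω), Z (n + r + j) ω)}
      ≤ 2 * (Real.exp (-L) + ((m : ℝ) - 1) * betaCoeff μ Z a) + betaCoeff μ Z r := by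
  set T := Real.sqrt (2 * (m * (a * sigmaTilde (betaCoeff μ Z) a ^ 2)) * L) + a / 3 * L with hT
  set p : (Fin n → E) → ℝ := fun z => μ.real {ω' | (z, Z 0 ω') ∈ G} with hp
  have mp : Measurable p := by
    have h := (measurable_measure_prodMk_left (ν := μ.map (Z 0)) hG).ennreal_toReal
    convert h using 2 with z
    rw [Measure.map_apply (hZ _) (measurable_prodMk_left hG)]
    rfl
  let S : Set ((Fin n → E) × (ℕ → E)) := {x | 2 * m * a * p x.1 + 2 * T
    ≤ ∑ j ∈ Finset.range (2 * m * a), G.indicator (fun _ => (1 : ℝ)) (x.1, x.2 j)}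
  have mS : MeasurableSet S := by
    refine measurableSet_le (((mp.comp measurable_fst).const_mul _).add_const _)
      (Finset.measurable_fun_sum _ fun j _ => ?_)
    exact (measurable_const.indicator hG).comp
      (measurable_fst.prodMk ((measurable_pi_apply j).comp measurable_snd))
  have key := abs_measureReal_sub_integral_le_betaCoeff hstat hZ (k := n) (a := r)
    (measurable_initialSample n) (dependsOn_initialSample n)
    (Ψ := fun (x : ℤ → E) (j : ℕ) => x (n + r + j))
    (measurable_pi_lambda _ fun _ => measurable_pi_apply _)
    (fun x y h => funext fun j => h _ (by simp)) mS
  have hz : ∀ z, μ.real {ω' | (z, fun j : ℕ => path Z ω' (n + r + j)) ∈ S}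
      ≤ 2 * (Real.exp (-L) + ((m : ℝ) - 1) * betaCoeff μ Z a) := by
    intro z
    let A : Set E := Prod.mk z ⁻¹' G
    have mA : MeasurableSet A := measurable_prodMk_left hG
    have hsub : {ω' | (z, fun j : ℕ => path Z ω' (n + r + j)) ∈ S}
        ⊆ {ω | T ≤ alternatingSum (centredIndicator A (μ.real (Z 0 ⁻¹' A))) (n + r) a m (path Z ω)}
        ∪ {ω | T ≤ alternatingSum (centredIndicator A (μ.real (Z 0 ⁻¹' A))) (n + r + a) a m
            (path Z ω)} := by
      intro ω hω
      have h1 := sum_range_eq_alternatingSum (centredIndicator A (μ.real (Z 0 ⁻¹' A)))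
        (n + r) a m (path Z ω)
      have hω' : 2 * m * a * μ.real (Z 0 ⁻¹' A) + 2 * T ≤ ∑ j ∈ Finset.range (2 * m * a),
        A.indicator (fun _ => (1 : ℝ)) (path Z ω (n + r + j)) := hω
      simp only [centredIndicator, Finset.sum_sub_distrib, Finset.sum_const, Finset.card_range,
        nsmul_eq_mul] at h1
      push_cast at h1
      by_contra hcon
      simp only [Set.mem_union, Set.mem_ofPred_eq, not_or, not_le] at hcon
      have h2 := hcon.1
      have h3 := hcon.2
      linarith
    refine (measureReal_mono hsub).trans ((measureReal_union_le _ _).trans ?_)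
    linarith [measureReal_bernstein_le hstat hZ mA ha hm hL (n + r),
      measureReal_bernstein_le hstat hZ mA ha hm hL (n + r + a)]
  have hint : ∫ ω, μ.real {ω' | (initialSample n (path Z ω),
        fun j : ℕ => path Z ω' (n + r + j)) ∈ S} ∂μ
      ≤ ∫ _, 2 * (Real.exp (-L) + ((m : ℝ) - 1) * betaCoeff μ Z a) ∂μ :=
    integral_mono_of_nonneg (ae_of_all _ fun ω => measureReal_nonneg) (integrable_const _)
      (ae_of_all _ fun ω => hz _)
  rw [integral_const, probReal_univ, one_smul] at hint
  have := (abs_le.1 key).2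
  change μ.real {ω | (initialSample n (path Z ω), fun j : ℕ => path Z ω (n + r + j)) ∈ S} ≤ _
  linarith

end Conditional

/-! ### The calibration quantile -/

section CalibrationQuantile

variable {Ω 𝒳 𝒴 : Type*} {nTrain nCal : ℕ} {s : (Fin nTrain → 𝒳 × 𝒴) → 𝒳 × 𝒴 → ℝ}
  {X : ℤ → Ω → 𝒳} {Y : ℤ → Ω → 𝒴} {α : ℝ}

lemma monotone_calCDF (ω : Ω) : Monotone (calCDF nCal s X Y ω) := by
  intro t u htu
  refine mul_le_mul_of_nonneg_left (Finset.sum_le_sum fun i _ => ?_) (by positivity)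
  exact Set.indicator_le_indicator_of_subset (fun v (hv : v ≤ t) => hv.trans htu)
    (fun _ => zero_le_one) _

lemma nonempty_setOf_le_calCDF (hn : 0 < nCal) (hα : 0 < α) (ω : Ω) :
    {t | 1 - α ≤ calCDF nCal s X Y ω t}.Nonempty := by
  set f : ℕ → ℝ := fun i => trainedScore s X Y ω (X i ω) (Y i ω)
  refine ⟨∑ i ∈ Finset.Icc (nTrain + 1) (nTrain + nCal), |f i|, ?_⟩
  have h : calCDF nCal s X Y ω (∑ i ∈ Finset.Icc (nTrain + 1) (nTrain + nCal), |f i|) = 1 := by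
    rw [calCDF, Finset.sum_congr rfl (g := fun _ => (1 : ℝ))]
    · have : (nCal : ℝ) ≠ 0 := by positivity
      simp [this]
    · intro i hi
      refine Set.indicator_of_mem ?_ _
      exact (le_abs_self _).trans
        (Finset.single_le_sum (f := fun i => |f i|) (fun _ _ => abs_nonneg _) hi)
  simp only [Set.mem_ofPred_eq, h]
  linarith

lemma bddBelow_setOf_le_calCDF (hα : α < 1) (ω : Ω) :
    BddBelow {t | 1 - α ≤ calCDF nCal s X Y ω t} := by
  set f : ℕ → ℝ := fun i => trainedScore s X Y ω (X i ω) (Y i ω)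
  refine ⟨-∑ i ∈ Finset.Icc (nTrain + 1) (nTrain + nCal), |f i|, fun t ht => ?_⟩
  by_contra! hlt
  have h : calCDF nCal s X Y ω t = 0 := by
    rw [calCDF, Finset.sum_eq_zero, mul_zero]
    intro i hi
    refine Set.indicator_of_notMem (fun hle => ?_) _
    have h1 := Finset.single_le_sum (f := fun i => |f i|) (fun _ _ => abs_nonneg _) hi
    have h2 : f i ≤ t := hle
    linarith [neg_abs_le (f i)]
  have ht' : 1 - α ≤ calCDF nCal s X Y ω t := ht
  linarith

lemma calQuantile_lt_iff (hn : 0 < nCal) (hα : α ∈ Set.Ioo (0 : ℝ) 1) (ω : Ω) {x : ℝ} :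
    calQuantile nCal s X Y α ω < x ↔ ∃ t < x, 1 - α ≤ calCDF nCal s X Y ω t := by
  rw [calQuantile, csInf_lt_iff (bddBelow_setOf_le_calCDF hα.2 ω)
    (nonempty_setOf_le_calCDF hn hα.1 ω)]
  exact ⟨fun ⟨t, h, h'⟩ => ⟨t, h', h⟩, fun ⟨t, h, h'⟩ => ⟨t, h', h⟩⟩

/-- If the calibration quantile is below `x`, then a fraction at least `1 - α` of the calibration
scores is below `x`. -/
lemma le_sum_of_calQuantile_lt (hn : 0 < nCal) (hα : α ∈ Set.Ioo (0 : ℝ) 1) {ω : Ω} {x : ℝ}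
    (h : calQuantile nCal s X Y α ω < x) :
    nCal * (1 - α) ≤ ∑ i ∈ Finset.Icc (nTrain + 1) (nTrain + nCal),
      (Set.Iio x).indicator (fun _ => (1 : ℝ)) (trainedScore s X Y ω (X i ω) (Y i ω)) := by
  obtain ⟨t, htx, ht⟩ := (calQuantile_lt_iff hn hα ω).1 h
  have hn' : (0 : ℝ) < nCal := by exact_mod_cast hn
  rw [calCDF, one_div, ← div_eq_inv_mul, le_div_iff₀ hn', mul_comm] at ht
  refine ht.trans (Finset.sum_le_sum fun i _ => ?_)
  exact Set.indicator_le_indicator_of_subset (fun v (hv : v ≤ t) => hv.trans_lt htx)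
    (fun _ => zero_le_one) _

variable [MeasurableSpace Ω] [MeasurableSpace 𝒳] [MeasurableSpace 𝒴]

lemma measurable_pairs (hX : ∀ t, Measurable (X t)) (hY : ∀ t, Measurable (Y t)) (t : ℤ) :
    Measurable (pairs X Y t) := (hX t).prodMk (hY t)

lemma measurable_trainSample (hX : ∀ t, Measurable (X t)) (hY : ∀ t, Measurable (Y t)) :
    Measurable (trainSample X Y nTrain) :=
  measurable_pi_lambda _ fun _ => measurable_pairs hX hY _

lemma measurable_score (hX : ∀ t, Measurable (X t)) (hY : ∀ t, Measurable (Y t))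
    (hs : Measurable (Function.uncurry s)) (t : ℤ) :
    Measurable fun ω => trainedScore s X Y ω (X t ω) (Y t ω) :=
  hs.comp ((measurable_trainSample hX hY).prodMk (measurable_pairs hX hY t))

lemma measurable_calQuantile (hn : 0 < nCal) (hα : α ∈ Set.Ioo (0 : ℝ) 1)
    (hX : ∀ t, Measurable (X t)) (hY : ∀ t, Measurable (Y t))
    (hs : Measurable (Function.uncurry s)) : Measurable (calQuantile nCal s X Y α) := by
  refine measurable_of_Iio fun x => ?_
  have e : calQuantile nCal s X Y α ⁻¹' Set.Iio x
      = ⋃ t : {t : ℚ // (t : ℝ) < x}, {ω | 1 - α ≤ calCDF nCal s X Y ω (t : ℚ)} := by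
    ext ω
    simp only [Set.mem_preimage, Set.mem_Iio, calQuantile_lt_iff hn hα, Set.mem_iUnion,
      Set.mem_ofPred_eq]
    constructor
    · rintro ⟨t, htx, ht⟩
      obtain ⟨u, htu, hux⟩ := exists_rat_btwn htx
      exact ⟨⟨u, hux⟩, ht.trans (monotone_calCDF ω htu.le)⟩
    · rintro ⟨t, ht⟩
      exact ⟨t, t.2, ht⟩
  rw [e]
  refine MeasurableSet.iUnion fun t => measurableSet_le measurable_const ?_
  refine (Finset.measurable_fun_sum _ fun i _ => ?_).const_mul _
  exact (measurable_const.indicator measurableSet_Iic).comp (measurable_score hX hY hs i)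

lemma measurableSet_coverEvent (hn : 0 < nCal) (hα : α ∈ Set.Ioo (0 : ℝ) 1)
    (hX : ∀ t, Measurable (X t)) (hY : ∀ t, Measurable (Y t))
    (hs : Measurable (Function.uncurry s)) (i : ℕ) :
    MeasurableSet (coverEvent nCal s X Y α i) :=
  measurableSet_le (measurable_score hX hY hs i) (measurable_calQuantile hn hα hX hY hs)

end CalibrationQuantile

/-! ### The deviation bound -/

section DeviationBound

variable {β : ℕ → ℝ} {nCal : ℕ} {δ : ℝ}

lemma finite_feasible : (feasible β nCal δ).Finite := by
  refine Set.Finite.subset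
    ((Set.finite_Iic nCal).prod ((Set.finite_Iic nCal).prod (Set.finite_Iic (nCal + 1)))) ?_
  rintro ⟨a, m, r⟩ ⟨ha, hm, hr, h, -⟩
  simp only at ha hm hr h
  have h1 : a ≤ m * a := Nat.le_mul_of_pos_left _ hm
  have h2 : m ≤ m * a := Nat.le_mul_of_pos_right _ ha
  have h3 : 2 * (m * a) + r = nCal + 1 := by zify; linarith
  exact ⟨Set.mem_Iic.2 (by lia), Set.mem_Iic.2 (by lia), Set.mem_Iic.2 (by lia)⟩

/-- The infimum in the definition of `ε_cal` is attained, as it runs over finitely many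
triples. -/
lemma exists_feasible_eq_epsCal (h : (feasible β nCal δ).Nonempty) :
    ∃ a m r, (a, m, r) ∈ feasible β nCal δ ∧ epsCal β nCal δ = blockBound β nCal δ a m r := by
  obtain ⟨⟨a, m, r⟩, h1, h2⟩ := (h.image _).csInf_mem
    (finite_feasible.image fun p : ℕ × ℕ × ℕ => blockBound β nCal δ p.1 p.2.1 p.2.2)
  exact ⟨a, m, r, h1, h2.symm⟩

/-- The sum of the deviations of the odd and the even blocks is the total number of observations
in the blocks times the deviation of their average. -/
lemma two_mul_block_deviation_eq {a m : ℕ} (ha : 0 < a) (hm : 0 < m) {σ L : ℝ} (hσ : 0 ≤ σ) :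
    2 * (Real.sqrt (2 * (m * (a * σ ^ 2)) * L) + a / 3 * L)
      = 2 * m * a * (σ * Real.sqrt (4 / (2 * m * a) * L) + 1 / (3 * m) * L) := by
  have ha' : (0 : ℝ) < a := by exact_mod_cast ha
  have hm' : (0 : ℝ) < m := by exact_mod_cast hm
  have h : Real.sqrt (2 * (m * (a * σ ^ 2)) * L)
      = m * a * σ * Real.sqrt (4 / (2 * m * a) * L) := by
    rw [show 2 * (m * (a * σ ^ 2)) * L = (m * a * σ) ^ 2 * (4 / (2 * m * a) * L) by
      field_simp; ring, Real.sqrt_mul (sq_nonneg _), Real.sqrt_sq (by positivity)]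
  rw [h]
  field_simp

/-- Dropping the first `r - 1` terms of a sum of `[0, 1]`-valued terms costs at most `r - 1`. -/
lemma sum_Icc_le_add_sum_range {h : ℕ → ℝ} (h1 : ∀ i, h i ≤ 1) {n k r N : ℕ} (hr : 0 < r)
    (hN : N + r = k + 1) :
    ∑ i ∈ Finset.Icc (n + 1) (n + k), h i
      ≤ ((r : ℝ) - 1) + ∑ j ∈ Finset.range N, h (n + r + j) := by
  have e : Finset.Icc (n + 1) (n + k) = Finset.Ico (n + 1) (n + r + N) := by
    ext i; simp only [Finset.mem_Icc, Finset.mem_Ico]; lia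
  rw [e, ← Finset.sum_Ico_consecutive h (show n + 1 ≤ n + r by lia) (by lia),
    Finset.sum_Ico_eq_sum_range h (n + r), Nat.add_sub_cancel_left]
  gcongr
  refine (Finset.sum_le_sum fun i _ => h1 i).trans_eq ?_
  rw [Finset.sum_const, Nat.card_Ico, nsmul_eq_mul, mul_one,
    show n + r - (n + 1) = r - 1 by lia, Nat.cast_sub hr, Nat.cast_one]

end DeviationBound

/-! ### Coverage -/

section Coverage

variable {Ω 𝒳 𝒴 : Type*} [MeasurableSpace Ω] [MeasurableSpace 𝒳] [MeasurableSpace 𝒴]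
  {μ : Measure Ω} [IsProbabilityMeasure μ] {X : ℤ → Ω → 𝒳} {Y : ℤ → Ω → 𝒴}
  {nTrain nCal : ℕ} {s : (Fin nTrain → 𝒳 × 𝒴) → 𝒳 × 𝒴 → ℝ} {α δ : ℝ}

/-- The calibration quantile is unlikely to fall below a threshold `q`, computed from the training
sample, such that a new score is below `q` with probability at most `1 - α - ε`. -/
lemma measureReal_calQuantile_lt_le (hX : ∀ t, Measurable (X t)) (hY : ∀ t, Measurable (Y t))
    (hstat : IsStationary μ (pairs X Y)) (hs : Measurable (Function.uncurry s))
    (hα : α ∈ Set.Ioo (0 : ℝ) 1) (hδ : δ ∈ Set.Ioo (0 : ℝ) 1) {a m r : ℕ}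
    (hf : (a, m, r) ∈ feasible (betaCoeff μ (pairs X Y)) nCal δ)
    {q : (Fin nTrain → 𝒳 × 𝒴) → ℝ} (hq : Measurable q)
    (hqs : ∀ z, μ.real {ω | s z (pairs X Y 0 ω) < q z}
      ≤ 1 - α - blockBound (betaCoeff μ (pairs X Y)) nCal δ a m r) :
    μ.real {ω | calQuantile nCal s X Y α ω < q (trainSample X Y nTrain ω)} ≤ δ := by
  set β := betaCoeff μ (pairs X Y) with hβ
  have hZ := measurable_pairs hX hY
  obtain ⟨ha, hm, hr, hn, hd⟩ := hf
  simp only at ha hm hr hn hd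
  have hN : 2 * m * a + r = nCal + 1 := by zify; linarith
  have hncal : 0 < nCal := by
    have : 0 < m * a := Nat.mul_pos hm ha
    lia
  have hNR : (2 * m * a : ℝ) + r = nCal + 1 := by exact_mod_cast hN
  have hrR : (1 : ℝ) ≤ r := by exact_mod_cast hr
  have hmR : (1 : ℝ) ≤ m := by exact_mod_cast hm
  have hncalR : (0 : ℝ) < nCal := by exact_mod_cast hncal
  set x := δ - 4 * ((m : ℝ) - 1) * β a - β r with hx
  have hx0 : 0 < x := by linarith
  have hmβ : 0 ≤ ((m : ℝ) - 1) * β a := mul_nonneg (by linarith) (betaCoeff_nonneg a)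
  have hrβ : 0 ≤ β r := betaCoeff_nonneg r
  set L := logTerm β δ a m r with hL
  have hL' : L = Real.log (4 / x) := rfl
  have hL0 : 0 ≤ L := by
    refine Real.log_nonneg ((one_le_div hx0).2 ?_)
    linarith [hδ.2]
  have hexp : Real.exp (-L) = x / 4 := by
    rw [hL', Real.exp_neg, Real.exp_log (by positivity), inv_div]
  set σ := sigmaTilde β a with hσ
  have hσ0 : 0 ≤ σ := Real.sqrt_nonneg _
  let G : Set ((Fin nTrain → 𝒳 × 𝒴) × (𝒳 × 𝒴)) := {w | s w.1 w.2 < q w.1}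
  have mG : MeasurableSet G := measurableSet_lt hs (hq.comp measurable_fst)
  have key := measureReal_calibration_deviation_le hstat hZ nTrain ha hm r hL0 mG
  rw [← hβ, ← hσ, hexp] at key
  refine (measureReal_mono ?_).trans (key.trans ?_)
  · intro ω hω
    set p := μ.real {ω' | (initialSample nTrain (path (pairs X Y) ω), pairs X Y 0 ω') ∈ G} with hp
    have hp0 : 0 ≤ p := measureReal_nonneg
    have h1 := le_sum_of_calQuantile_lt hncal hα hω
    have h2 := sum_Icc_le_add_sum_range (n := nTrain) (k := nCal)
      (h := fun i : ℕ => (Set.Iio (q (trainSample X Y nTrain ω))).indicator (fun _ => (1 : ℝ))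
        (trainedScore s X Y ω (X i ω) (Y i ω)))
      (fun i => Set.indicator_le_self' (fun _ _ => zero_le_one) _) hr hN
    have h3 : p ≤ 1 - α - blockBound β nCal δ a m r := hqs (trainSample X Y nTrain ω)
    have e : ∀ j : ℕ, G.indicator (fun _ => (1 : ℝ))
          (initialSample nTrain (path (pairs X Y) ω), pairs X Y (nTrain + r + j) ω)
        = (Set.Iio (q (trainSample X Y nTrain ω))).indicator (fun _ => (1 : ℝ))
          (trainedScore s X Y ω (X ((nTrain + r + j : ℕ) : ℤ) ω)
            (Y ((nTrain + r + j : ℕ) : ℤ) ω)) := by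
      intro j
      push_cast
      rfl
    simp only [Set.mem_ofPred_eq, e]
    rw [two_mul_block_deviation_eq ha hm hσ0]
    set D := σ * Real.sqrt (4 / (2 * m * a) * L) + 1 / (3 * m) * L with hD
    have hD0 : 0 ≤ D := by positivity
    have hbb : blockBound β nCal δ a m r = D + (r - 1) / nCal := by
      rw [blockBound, hD, show (nCal : ℝ) - r + 1 = 2 * m * a by linarith]
    have h4 : nCal * (p + D) ≤ nCal * (1 - α) - (r - 1) := by
      rw [hbb] at h3
      have h5 : nCal * (p + D) ≤ nCal * (1 - α - (r - 1) / nCal) := by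
        gcongr; linarith
      rwa [mul_sub, mul_div_cancel₀ _ hncalR.ne'] at h5
    have h6 : 2 * m * a * (p + D) ≤ nCal * (p + D) := by
      gcongr; linarith
    linarith
  · linarith

lemma blockBound_pos {β : ℕ → ℝ} (hβ : ∀ k, 0 ≤ β k) (hδ : δ ∈ Set.Ioo (0 : ℝ) 1) {a m r : ℕ}
    (hf : (a, m, r) ∈ feasible β nCal δ) : 0 < blockBound β nCal δ a m r := by
  obtain ⟨ha, hm, hr, hn, hd⟩ := hf
  simp only at ha hm hr hn hd
  have hmR : (1 : ℝ) ≤ m := by exact_mod_cast hm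
  have hrR : (1 : ℝ) ≤ r := by exact_mod_cast hr
  have hmβ : 0 ≤ ((m : ℝ) - 1) * β a := mul_nonneg (by linarith) (hβ a)
  have hL : 0 < logTerm β δ a m r := by
    refine Real.log_pos ((one_lt_div (by linarith)).2 ?_)
    linarith [hδ.2, hβ r]
  have h1 : 0 ≤ sigmaTilde β a := Real.sqrt_nonneg _
  have h2 : 0 ≤ ((r : ℝ) - 1) / nCal := div_nonneg (by linarith) (by positivity)
  unfold blockBound
  positivity

/-- The bound on the expected shortfall of the conditional coverage. -/
theorem integral_max_sub_condExp_coverEvent_le (hX : ∀ t, Measurable (X t))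
    (hY : ∀ t, Measurable (Y t)) (hstat : IsStationary μ (pairs X Y))
    (hs : Measurable (Function.uncurry s))
    (hα : α ∈ Set.Ioo (0 : ℝ) 1) (hδ : δ ∈ Set.Ioo (0 : ℝ) 1)
    (hf : (feasible (betaCoeff μ (pairs X Y)) nCal δ).Nonempty) (hn : 0 < nCal) (j : ℕ) :
    ∫ ω, max 0 (1 - α - epsCal (betaCoeff μ (pairs X Y)) nCal δ
        - (μ⟦coverEvent nCal s X Y α (nTrain + j) | trainSigma X Y nTrain⟧) ω) ∂μ
      ≤ δ + betaCoeff μ (pairs X Y) j := by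
  obtain ⟨a, m, r, hamr, he⟩ := exists_feasible_eq_epsCal hf
  have hZ := measurable_pairs hX hY
  have mT : Measurable (trainSample X Y nTrain) := measurable_trainSample hX hY
  have hε : 0 < epsCal (betaCoeff μ (pairs X Y)) nCal δ :=
    he ▸ blockBound_pos betaCoeff_nonneg hδ hamr
  set c := 1 - α - epsCal (betaCoeff μ (pairs X Y)) nCal δ with hc
  set C := coverEvent nCal s X Y α (nTrain + j) with hC
  have mC : MeasurableSet C := measurableSet_coverEvent hn hα hX hY hs _
  have iInd : ∀ {S : Set Ω}, MeasurableSet S → Integrable (S.indicator fun _ => (1 : ℝ)) μ :=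
    fun hS => (integrable_const _).indicator hS
  have hnonneg : ∀ S : Set Ω, ∀ᵐ ω ∂μ, 0 ≤ (μ⟦S | trainSigma X Y nTrain⟧) ω := fun S =>
    condExp_nonneg (ae_of_all _ fun ω => Set.indicator_nonneg (fun _ _ => zero_le_one) ω)
  rcases le_or_gt c 0 with hc0 | hc0
  · -- The guaranteed level is not positive, and there is no shortfall at all.
    refine (integral_eq_zero_of_ae ?_).trans_le (add_nonneg hδ.1.le (betaCoeff_nonneg j))
    filter_upwards [hnonneg C] with ω hω
    exact max_eq_left (by linarith)
  have hc1 : c < 1 := by linarith [hα.1]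
  have hsz : ∀ z, Measurable (s z) := fun z => hs.comp measurable_prodMk_left
  -- The threshold is the `c`-quantile of the score of a new observation, for a fixed training
  -- sample.
  have := Measure.isProbabilityMeasure_map (μ := μ) (hZ 0).aemeasurable
  let q : (Fin nTrain → 𝒳 × 𝒴) → ℝ := fun z => quantile ((μ.map (pairs X Y 0)).map (s z)) c
  have mq : Measurable q := measurable_quantile_map hs hc0 hc1
  have hq1 : ∀ z, μ.real {ω | s z (pairs X Y 0 ω) < q z} ≤ c := by
    intro z
    have := Measure.isProbabilityMeasure_map (μ := μ.map (pairs X Y 0)) (hsz z).aemeasurable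
    have h := measureReal_Iio_quantile_le (ρ := (μ.map (pairs X Y 0)).map (s z)) hc0 hc1
    rw [map_measureReal_apply (hsz z) measurableSet_Iio,
      map_measureReal_apply (hZ 0) (hsz z measurableSet_Iio)] at h
    exact h
  have hq2 : ∀ z, c ≤ μ.real {ω | s z (pairs X Y (nTrain + j) ω) ≤ q z} := by
    intro z
    have := Measure.isProbabilityMeasure_map (μ := μ.map (pairs X Y 0)) (hsz z).aemeasurable
    have h := le_measureReal_Iic_quantile (ρ := (μ.map (pairs X Y 0)).map (s z)) hc1
    rw [map_measureReal_apply (hsz z) measurableSet_Iic, ← hstat.map_eq hZ (nTrain + j),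
      map_measureReal_apply (hZ _) (hsz z measurableSet_Iic), hstat.map_eq hZ (nTrain + j)] at h
    exact h
  let G : Set ((Fin nTrain → 𝒳 × 𝒴) × (𝒳 × 𝒴)) := {w | s w.1 w.2 ≤ q w.1}
  have mG : MeasurableSet G := measurableSet_le hs (mq.comp measurable_fst)
  let V : Set Ω := {ω | (trainSample X Y nTrain ω, pairs X Y (nTrain + j) ω) ∈ G}
  have mV : MeasurableSet V := (mT.prodMk (hZ _)) mG
  let U : Set Ω := {ω | calQuantile nCal s X Y α ω < q (trainSample X Y nTrain ω)}
  have mU : MeasurableSet U :=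
    measurableSet_lt (measurable_calQuantile hn hα hX hY hs) (mq.comp mT)
  have hU : μ.real U ≤ δ := measureReal_calQuantile_lt_le hX hY hstat hs hα hδ hamr mq
    (by rw [← he]; exact hq1)
  have hV : ∫ ω, max 0 (c - (μ⟦V | trainSigma X Y nTrain⟧) ω) ∂μ
      ≤ betaCoeff μ (pairs X Y) j := integral_max_sub_condExp_le hstat hZ nTrain j mG hq2
  -- Coverage can fail only if the score exceeds the threshold or the threshold exceeds the
  -- calibration quantile.
  have hle : V.indicator (fun _ => (1 : ℝ)) - U.indicator (fun _ => (1 : ℝ))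
      ≤ C.indicator fun _ => (1 : ℝ) := by
    intro ω
    by_cases h1 : ω ∈ V
    · by_cases h2 : ω ∈ U
      · simp only [Pi.sub_apply, Set.indicator_of_mem h1, Set.indicator_of_mem h2, sub_self]
        exact Set.indicator_nonneg (fun _ _ => zero_le_one) ω
      · have h3 : ω ∈ C := by
          have h4 : trainedScore s X Y ω (X (nTrain + j) ω) (Y (nTrain + j) ω)
            ≤ q (trainSample X Y nTrain ω) := h1
          have h5 : trainedScore s X Y ω (X (nTrain + j) ω) (Y (nTrain + j) ω)
            ≤ calQuantile nCal s X Y α ω := h4.trans (not_lt.1 h2)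
          simpa [hC, coverEvent, predictionSet] using h5
        simp [h1, h2, h3]
    · simp only [Pi.sub_apply, Set.indicator_of_notMem h1]
      have h6 : 0 ≤ U.indicator (fun _ => (1 : ℝ)) ω :=
        Set.indicator_nonneg (fun _ _ => zero_le_one) ω
      have h7 : 0 ≤ C.indicator (fun _ => (1 : ℝ)) ω :=
        Set.indicator_nonneg (fun _ _ => zero_le_one) ω
      linarith
  have hcond := condExp_mono (m := trainSigma X Y nTrain) ((iInd mV).sub (iInd mU)) (iInd mC)
    (ae_of_all _ hle)
  have hsub := condExp_sub (iInd mV) (iInd mU) (trainSigma X Y nTrain)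
  have imax : Integrable (fun ω => max 0 (c - (μ⟦V | trainSigma X Y nTrain⟧) ω)) μ :=
    (integrable_const _).sup ((integrable_const _).sub integrable_condExp)
  calc ∫ ω, max 0 (c - (μ⟦C | trainSigma X Y nTrain⟧) ω) ∂μ
      ≤ ∫ ω, (max 0 (c - (μ⟦V | trainSigma X Y nTrain⟧) ω)
          + (μ⟦U | trainSigma X Y nTrain⟧) ω) ∂μ := by
        refine integral_mono_of_nonneg (ae_of_all _ fun ω => le_max_left _ _)
          (imax.add integrable_condExp) ?_
        filter_upwards [hcond, hsub, hnonneg U] with ω h1 h2 h3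
        rw [h2, Pi.sub_apply] at h1
        refine max_le (add_nonneg (le_max_left _ _) h3) ?_
        linarith [le_max_right 0 (c - (μ⟦V | trainSigma X Y nTrain⟧) ω)]
    _ = ∫ ω, max 0 (c - (μ⟦V | trainSigma X Y nTrain⟧) ω) ∂μ + μ.real U := by
        rw [integral_add imax integrable_condExp, integral_condExp mT.comap_le,
          integral_indicator_const _ mU, smul_eq_mul, mul_one]
    _ ≤ δ + betaCoeff μ (pairs X Y) j := by linarith

end Coverage

end ConformalMixing

theorem mainTheorem2 {Ω 𝒳 𝒴 : Type*} [MeasurableSpace Ω] [MeasurableSpace 𝒳] [MeasurableSpace 𝒴]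
    (μ : Measure Ω) [IsProbabilityMeasure μ]
    (X : ℤ → Ω → 𝒳) (Y : ℤ → Ω → 𝒴)
    (hX : ∀ t, Measurable (X t)) (hY : ∀ t, Measurable (Y t))
    (hstat : ConformalMixing.IsStationary μ (ConformalMixing.pairs X Y))
    (hmix : ConformalMixing.IsBetaMixing μ (ConformalMixing.pairs X Y))
    (nTrain nCal nTest : ℕ)
    (s : (Fin nTrain → 𝒳 × 𝒴) → 𝒳 × 𝒴 → ℝ) (hs : Measurable (Function.uncurry s))
    (α : ℝ) (hα : α ∈ Set.Ioo (0 : ℝ) 1)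
    (δcal : ℝ) (hδ : δcal ∈ Set.Ioo (0 : ℝ) 1)
    (hfeas : (ConformalMixing.feasible
      (ConformalMixing.betaCoeff μ (ConformalMixing.pairs X Y)) nCal δcal).Nonempty)
    (i : ℕ) (hi : i ∈ Finset.Icc (nTrain + nCal + 1) (nTrain + nCal + nTest)) :
    let β : ℕ → ℝ := ConformalMixing.betaCoeff μ (ConformalMixing.pairs X Y)
    let εcal : ℝ := ConformalMixing.epsCal β nCal δcal
    let εtrain : ℝ := β (i - nTrain)
    let cover : Set Ω := ConformalMixing.coverEvent nCal s X Y α i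
    let coverTr : Ω → ℝ := μ⟦cover | ConformalMixing.trainSigma X Y nTrain⟧
    1 - α - (δcal + εtrain + εcal) ≤ μ.real cover ∧
    ∫ ω, max 0 (1 - α - εcal - coverTr ω) ∂μ ≤ δcal + εtrain := by
  intro β εcal εtrain cover coverTr
  have hn : 0 < nCal := by
    obtain ⟨⟨a, m, r⟩, ha, hm, hr, h, -⟩ := hfeas
    simp only at ha hm hr h
    have h1 : 0 < m * a := Nat.mul_pos hm ha
    have h2 : 2 * (m * a) + r = nCal + 1 := by zify; linarith
    lia
  obtain ⟨j, rfl⟩ : ∃ j, i = nTrain + j := by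
    have := (Finset.mem_Icc.1 hi).1
    exact ⟨i - nTrain, by lia⟩
  have hshort : ∫ ω, max 0 (1 - α - εcal - coverTr ω) ∂μ ≤ δcal + εtrain := by
    have h := ConformalMixing.integral_max_sub_condExp_coverEvent_le hX hY hstat hs hα hδ hfeas
      hn j
    simpa only [εtrain, Nat.add_sub_cancel_left] using h
  refine ⟨?_, hshort⟩
  -- The conditional coverage has mean `μ.real cover`, and the positive part is at least its
  -- argument.
  have mcover : MeasurableSet cover :=
    ConformalMixing.measurableSet_coverEvent hn hα hX hY hs _
  have hmean : ∫ ω, coverTr ω ∂μ = μ.real cover := by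
    simp only [coverTr]
    rw [integral_condExp (ConformalMixing.measurable_trainSample hX hY).comap_le,
      integral_indicator_const _ mcover, smul_eq_mul, mul_one]
  have icover : Integrable coverTr μ := integrable_condExp
  have hsub : ∫ ω, (1 - α - εcal - coverTr ω) ∂μ = 1 - α - εcal - μ.real cover := by
    rw [integral_sub (integrable_const _) icover, hmean]
    simp
  have hle : ∫ ω, (1 - α - εcal - coverTr ω) ∂μ ≤ ∫ ω, max 0 (1 - α - εcal - coverTr ω) ∂μ :=
    integral_mono ((integrable_const _).sub icover)
      ((integrable_const _).sup ((integrable_const _).sub icover)) fun ω => le_max_right _ _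
  linarith
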